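/- **Setting.** Let $n,M,K\ge 1$, $N,T\ge 0$ be integers. Worker $i\in\{1,\dots,n\}$ has a data distribution $\mathcal D_i$ and a loss $F_i(x;\xi)$, differentiable in $x\in\mathbb R^N$. Put $f_i(x)=\mathbb E_{\xi\sim\mathcal D_i}F_i(x;\xi)$ and $f(x)=\sum_{i=1}^n p_if_i(x)$, where $p_i\ge 0$, $\sum_ip_i=1$, and let $f^*=\inf_x f(x)>-\infty$. AD-PSGD with step size $\gamma$ starts from $x_0^1=\dots=x_0^n=x_0$. At step $k=0,1,\dots$ a random worker $i_k$ with $\Pr(i_k=i)=p_i$, a random $n\times n$ matrix $W_k$ (which may depend on $i_k$) and a mini-batch $\xi_{k,1},\dots,\xi_{k,M}$ are drawn; given $(i_k,W_k)$ the batch is i.i.d. from $\mathcal D_{i_k}$, and the triples $(i_k,W_k,(\xi_{k,m})_m)$ are independent over $k$. The update is $$x_{k+1}^j=\sum_{l=1}^n (W_k)_{lj}\,x_k^l-\gamma\,\mathbf 1[j=i_k]\sum_{m=1}^M\nabla F_{i_k}\bigl(x_{k-\tau_k}^{i_k};\xi_{k,m}\bigr),\qquad 1\le j\le n,$$ with deterministic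 delays $0\le\tau_k\le\min(k,T)$. Write $\bar x_k=\frac1n\sum_{j=1}^n x_k^j$. **Assumptions.** (1) Every $f_i$ is differentiable with $L$-Lipschitz gradient, $L\ge 0$. (2) $W_k$ is almost surely doubly stochastic for every $k$. (3) There is $\rho\in[0,1)$ such that, if $n\ge 2$, $\max\{|\lambda_2(\mathbb E[W_k^\top W_k])|,|\lambda_n(\mathbb E[W_k^\top W_k])|\}\le\rho$ for all $k$, where $\lambda_j$ is the $j$-th largest eigenvalue. (4) $\mathbb E_{\xi\sim\mathcal D_i}\nabla F_i(x;\xi)=\nabla f_i(x)$ for all $i,x$. (5) $\mathbb E_{\xi\sim\mathcal D_i}\|\nabla F_i(x;\xi)-\nabla f_i(x)\|^2\le\sigma^2$ for all $i,x$, and $\sum_ip_i\|\nabla f_i(x)-\nabla f(x)\|^2\le\varsigma^2$ for all $x$, where $\sigma^2+6M\varsigma^2>0$. **Claim.** Let $$\bar\rho=\frac{n-1}{n}\Bigl(\frac1{1-\rho}+\frac{2\sqrt\rho}{(1-\sqrt\rho)^2}\Bigr),\qquad \gamma=\frac{n}{10ML+\sqrt{\sigma^2+6M\varsigma^2}\,\sqrt{KM}}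 .$$ If $$K\ \ge\ \frac{ML^2n^2}{\sigma^2+6M\varsigma^2}\max\Bigl\{192\Bigl(T\frac{n-1}n+\bar\rho\Bigr),\ \frac{64T^4}{n^2},\ 1024\,n^2\bar\rho^2,\ \frac{(8\sqrt6\,T^{2/3}+8)^2\bigl(T+\bar\rho\frac{n}{n-1}\bigr)^{2/3}(n-1)^{1/2}}{n^{1/6}}\Bigr\}$$ (the last entry being $0$ when $n=1$), then $\|\nabla f(\bar x_k)\|^2$ is integrable for every $k<K$ and $$\frac1K\sum_{k=0}^{K-1}\mathbb E\bigl\|\nabla f(\bar x_k)\bigr\|^2\ \le\ \frac{20\,(f(x_0)-f^*)\,L}{K}+\frac{2\,(f(x_0)-f^*+L)\sqrt{\sigma^2/M+6\varsigma^2}}{\sqrt K}.$$ -/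

import Mathlib

open MeasureTheory ProbabilityTheory
open scoped NNReal Matrix

namespace ADPSGD

noncomputable section

/-- The measurable structure on real matrices: that of the product `ℝ^(m × n)` of the entries. -/
instance matrixMeasurableSpace (m n : Type*) : MeasurableSpace (Matrix m n ℝ) :=
  inferInstanceAs (MeasurableSpace (m → n → ℝ))

/-- The loss of a worker with loss function `G` and local data distribution `D`:
`x ↦ 𝔼_{ζ ∼ D} G(x; ζ)`. -/
def localLoss {N : ℕ} {Z : Type*} [MeasurableSpace Z]
    (G : EuclideanSpace ℝ (Fin N) → Z → ℝ) (D : Measure Z) (x : EuclideanSpace ℝ (Fin N)) : ℝ :=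
  ∫ z, G x z ∂D

/-- The stochastic gradient `∇G(x; z)`, the gradient being taken in `x`. -/
def sampleGrad {N : ℕ} {Z : Type*} (G : EuclideanSpace ℝ (Fin N) → Z → ℝ)
    (x : EuclideanSpace ℝ (Fin N)) (z : Z) : EuclideanSpace ℝ (Fin N) :=
  gradient (fun y => G y z) x

/-- The objective `f(x) = ∑ᵢ pᵢ fᵢ(x)`, where `fᵢ(x) = 𝔼_{ζ ∼ Dᵢ} Fᵢ(x; ζ)`. -/
def objective {n N : ℕ} {Z : Type*} [MeasurableSpace Z]
    (F : Fin n → EuclideanSpace ℝ (Fin N) → Z → ℝ) (D : Fin n → Measure Z) (p : Fin n → ℝ)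
    (x : EuclideanSpace ℝ (Fin N)) : ℝ :=
  ∑ i, p i * localLoss (F i) (D i) x

/-- The local models of AD-PSGD along one realisation of its random choices.
`iterate F x₀ γ τ i W z k j` is `x_k^j`, the model of worker `j` after `k` updates, where
at step `k` the worker `i k` is selected, `W k` is the averaging matrix and
`z k 0, …, z k (M - 1)` is the sampled mini-batch:
`x_{k+1}^j = ∑ₗ x_k^l (W_k)_{l j} - γ 1[j = i_k] ∑ₘ ∇F_{i_k}(x_{k-τ_k}^{i_k}; z_{k,m})`. -/
def iterate {n N M : ℕ} {Z : Type*}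
    (F : Fin n → EuclideanSpace ℝ (Fin N) → Z → ℝ) (x₀ : EuclideanSpace ℝ (Fin N)) (γ : ℝ)
    (τ : ℕ → ℕ) (i : ℕ → Fin n) (W : ℕ → Matrix (Fin n) (Fin n) ℝ) (z : ℕ → Fin M → Z) :
    ℕ → Fin n → EuclideanSpace ℝ (Fin N)
  | 0 => fun _ => x₀
  | k + 1 => fun j =>
      (∑ l, W k l j • iterate F x₀ γ τ i W z k l) -
        if j = i k then
          γ • ∑ m, sampleGrad (F (i k)) (iterate F x₀ γ τ i W z (k - τ k) (i k)) (z k m)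
        else 0
  termination_by k => k
  decreasing_by all_goals omega

/-- The average `(1/n) ∑ⱼ x^j` of the local models, i.e. `X 1ₙ / n`. -/
def average {n N : ℕ} (X : Fin n → EuclideanSpace ℝ (Fin N)) : EuclideanSpace ℝ (Fin N) :=
  (n : ℝ)⁻¹ • ∑ j, X j

/-- The matrix `𝔼[Wᵀ W]` of a random matrix `W`, with entrywise expectation. -/
def secondMoment {n : ℕ} {Ω : Type*} [MeasurableSpace Ω] (P : Measure Ω)
    (W : Ω → Matrix (Fin n) (Fin n) ℝ) : Matrix (Fin n) (Fin n) ℝ :=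
  Matrix.of fun a b => ∫ ω, ((W ω)ᵀ * W ω) a b ∂P

theorem secondMoment_isHermitian {n : ℕ} {Ω : Type*} [MeasurableSpace Ω] (P : Measure Ω)
    (W : Ω → Matrix (Fin n) (Fin n) ℝ) : (secondMoment P W).IsHermitian := by
  ext a b
  simp [secondMoment, Matrix.mul_apply, mul_comm]

/-- `eig hA j` is the `(j + 1)`-st largest eigenvalue, with multiplicity, of the symmetric
matrix `A` (`j = 0, …, n - 1`); `Matrix.IsHermitian.eigenvalues₀` is sorted decreasingly. -/
def eig {n : ℕ} {A : Matrix (Fin n) (Fin n) ℝ} (hA : A.IsHermitian) (j : Fin n) : ℝ :=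
  hA.eigenvalues₀ (Fin.cast (Fintype.card_fin n).symm j)

/-- `ρ̄ = (n-1)/n · (1/(1-ρ) + 2√ρ/(1-√ρ)²)`. -/
def rhoBar (n : ℕ) (ρ : ℝ) : ℝ :=
  ((n : ℝ) - 1) / n * (1 / (1 - ρ) + 2 * √ρ / (1 - √ρ) ^ 2)

/-- The lower bound required of the number of iterations. For `n = 1` the last entry of the
maximum is `0`, because of its factor `(n-1)^(1/2)`. -/
def iterationThreshold (n M T : ℕ) (L σ ς ρ : ℝ) : ℝ :=
  (M * L ^ 2 * n ^ 2) / (σ ^ 2 + 6 * M * ς ^ 2) *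
    max (192 * (T * ((n - 1) / n) + rhoBar n ρ))
      (max (64 * T ^ 4 / n ^ 2)
        (max (1024 * n ^ 2 * rhoBar n ρ ^ 2)
          ((8 * √6 * (T : ℝ) ^ (2 / 3 : ℝ) + 8) ^ 2 *
              (T + rhoBar n ρ * (n / (n - 1))) ^ (2 / 3 : ℝ) * ((n : ℝ) - 1) ^ (1 / 2 : ℝ) /
            (n : ℝ) ^ (1 / 6 : ℝ))))

end

end ADPSGD

/-! Write `g k` for the sum of stochastic gradients used at step `k`, and `h k = ∑ a, p a •
∇f_a(x_{k-τ_k}^a)` for the mean direction. Double stochasticity makes the averaging step invisible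
to the mean model: `x̄_{k+1} = x̄_k - (γ/n) g k`. The sample of step `k` is independent of the past,
so `g k` has conditional mean `M h k`. The descent lemma and the polarization identity therefore
give an expected decrease of `γM/(2n) (‖∇f(x̄_k)‖² + ‖h k‖² - ‖∇f(x̄_k) - h k‖²)`, up to the noise
term `γ²L/(2n²) ‖g k‖²` (`IsRun.integral_objective_succ_le`).

The error `‖∇f(x̄_k) - h k‖²` has two sources: staleness, paid for by the at most `T` batch
gradients that moved the average since step `k - τ k`, and the consensus error, the `p`-weighted
distance of the local models from their average at that step. The second moment of `g k` is bounded
by a constant plus multiples of `‖h k‖²` and the same consensus error.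

For the consensus error, unroll the recursion. The deviation of worker `j` from the average is a sum
of past gradients weighted by entries of `W (t+1) ⋯ W (k-1)` minus `1/n`. These matrices are
independent of `g t`, and the spectral gap contracts vectors of sum zero, so a centred column of a
product of `m` matrices has expected squared norm at most `(n-1)/n * ρ^m`
(`integral_colDeviation_mixing_le`). Cauchy–Schwarz with geometric weights `r^m`, where `ρ ≤ r²`,
leaves a geometrically weighted sum of `𝔼‖g t‖²` (`IsRun.integral_norm_sub_average_sq_le`).

Summation over `k` gives a closed linear system between the sums of these five quantities
(`sum_grad_le`, `sum_grad_le_of_recursions`). The lower bound on `K` makes `γLM` so small that the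
feedback is absorbed by the retained term `‖h k‖²` and by the consensus error itself. What remains
is a term of order `1/γ` plus one of order `γ`, and the prescribed `γ` turns them into the rate
(`rate_of_stepSize`). -/

namespace ADPSGD

/-! ### Unrolled recursion, average model and pathwise consensus error -/

/-- The product `W t * W (t + 1) * ⋯ * W (t + m - 1)`. -/
def mixing {n : ℕ} (W : ℕ → Matrix (Fin n) (Fin n) ℝ) : ℕ → ℕ → Matrix (Fin n) (Fin n) ℝ
  | _, 0 => 1
  | t, m + 1 => W t * mixing W (t + 1) m

/-- The definition peels off the earliest matrix, which suits the contraction argument; the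
recursion in time appends the latest one. -/
theorem mixing_succ {n : ℕ} (W : ℕ → Matrix (Fin n) (Fin n) ℝ) (t m : ℕ) :
    mixing W t (m + 1) = mixing W t m * W (t + m) := by
  induction m generalizing t with
  | zero => simp [mixing]
  | succ m ih =>
    rw [mixing, ih, ← mul_assoc, ← mixing]
    congr 2
    omega

theorem mixing_mem_doublyStochastic {n : ℕ} {W : ℕ → Matrix (Fin n) (Fin n) ℝ}
    (hW : ∀ k, W k ∈ doublyStochastic ℝ (Fin n)) (t m : ℕ) :
    mixing W t m ∈ doublyStochastic ℝ (Fin n) := by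
  induction m generalizing t with
  | zero => exact one_mem _
  | succ m ih => exact mul_mem (hW t) (ih _)

/-- The gradient `g t` enters at worker `i t` and is then spread by the `k - 1 - t` matrices `W
(t+1), …, W (k-1)`. The common starting point is fixed by averaging because columns sum to one. -/
theorem eq_sub_sum_mixing {n : ℕ} {E : Type*} [AddCommGroup E] [Module ℝ E]
    {W : ℕ → Matrix (Fin n) (Fin n) ℝ} (hW : ∀ k, W k ∈ doublyStochastic ℝ (Fin n))
    {x : ℕ → Fin n → E} {x₀ : E} {γ : ℝ} {i : ℕ → Fin n} {g : ℕ → E} (h0 : ∀ j, x 0 j = x₀)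
    (hstep : ∀ k j, x (k + 1) j = (∑ l, W k l j • x k l) - if j = i k then γ • g k else 0)
    (k : ℕ) (j : Fin n) :
    x k j = x₀ - γ • ∑ t ∈ Finset.range k, mixing W (t + 1) (k - 1 - t) (i t) j • g t := by
  induction k generalizing j with
  | zero => simp [h0]
  | succ k ih =>
    have h1 : ∑ l, W k l j • x k l = x₀ - γ • ∑ t ∈ Finset.range k,
        mixing W (t + 1) (k - t) (i t) j • g t := by
      have h2 : ∀ t ∈ Finset.range k, mixing W (t + 1) (k - t) (i t) j • g t =
          ∑ l, W k l j • mixing W (t + 1) (k - 1 - t) (i t) l • g t := by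
        intro t ht
        rw [Finset.mem_range] at ht
        have h3 : k - t = (k - 1 - t) + 1 := by omega
        have h4 : t + 1 + (k - 1 - t) = k := by omega
        rw [h3, mixing_succ, h4, Matrix.mul_apply, Finset.sum_smul]
        exact Finset.sum_congr rfl fun l _ => by rw [smul_smul, mul_comm]
      rw [Finset.sum_congr rfl h2, Finset.sum_comm]
      simp_rw [ih, smul_sub, Finset.sum_sub_distrib, ← Finset.sum_smul,
        sum_col_of_mem_doublyStochastic (hW k) j, one_smul, Finset.smul_sum, smul_comm γ]
    rw [hstep, h1, Finset.sum_range_succ]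
    -- The newest gradient has not been averaged yet: its weight is an entry of the empty product,
    -- the identity matrix.
    have h5 : (if j = i k then γ • g k else 0) = γ • mixing W (k + 1) 0 (i k) j • g k := by
      by_cases h : j = i k
      · rw [if_pos h, h]
        simp [mixing]
      · simp [h, mixing, Ne.symm h]
    simp [h5, smul_add, sub_sub]

/-- Summing the unrolled formula over `j` replaces each mixing weight by a row sum, which is one. -/
theorem average_eq_sub_sum {n N : ℕ} (hn : n ≠ 0)
    {W : ℕ → Matrix (Fin n) (Fin n) ℝ} (hW : ∀ k, W k ∈ doublyStochastic ℝ (Fin n))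
    {x : ℕ → Fin n → EuclideanSpace ℝ (Fin N)} {x₀ : EuclideanSpace ℝ (Fin N)} {γ : ℝ}
    {i : ℕ → Fin n} {g : ℕ → EuclideanSpace ℝ (Fin N)} (h0 : ∀ j, x 0 j = x₀)
    (hstep : ∀ k j, x (k + 1) j = (∑ l, W k l j • x k l) - if j = i k then γ • g k else 0)
    (k : ℕ) : average (x k) = x₀ - γ • ∑ t ∈ Finset.range k, (n : ℝ)⁻¹ • g t := by
  have hn' : (n : ℝ) ≠ 0 := by exact_mod_cast hn
  unfold average
  simp_rw [eq_sub_sum_mixing hW h0 hstep k, Finset.sum_sub_distrib, ← Finset.smul_sum]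
  rw [Finset.sum_comm]
  simp_rw [← Finset.sum_smul, sum_row_of_mem_doublyStochastic (mixing_mem_doublyStochastic hW _ _),
    one_smul]
  rw [smul_sub, smul_comm γ]
  simp [← Nat.cast_smul_eq_nsmul ℝ, smul_smul, hn']

theorem average_succ {n N : ℕ} (hn : n ≠ 0)
    {W : ℕ → Matrix (Fin n) (Fin n) ℝ} (hW : ∀ k, W k ∈ doublyStochastic ℝ (Fin n))
    {x : ℕ → Fin n → EuclideanSpace ℝ (Fin N)} {x₀ : EuclideanSpace ℝ (Fin N)} {γ : ℝ}
    {i : ℕ → Fin n} {g : ℕ → EuclideanSpace ℝ (Fin N)} (h0 : ∀ j, x 0 j = x₀)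
    (hstep : ∀ k j, x (k + 1) j = (∑ l, W k l j • x k l) - if j = i k then γ • g k else 0)
    (k : ℕ) : average (x (k + 1)) = average (x k) - (γ / n) • g k := by
  rw [average_eq_sub_sum hn hW h0 hstep, average_eq_sub_sum hn hW h0 hstep,
    Finset.sum_range_succ, smul_add, smul_smul, sub_sub, div_eq_mul_inv]

/-- The squared distance of column `j` of `A` to the uniform vector. -/
noncomputable def colDeviation {n : ℕ} (A : Matrix (Fin n) (Fin n) ℝ) (j : Fin n) : ℝ :=
  ∑ l, (A l j - (n : ℝ)⁻¹) ^ 2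

theorem geom_sum_range_le {r : ℝ} (hr : 0 ≤ r) (hr1 : r < 1) (k : ℕ) :
    ∑ t ∈ Finset.range k, r ^ t ≤ (1 - r)⁻¹ :=
  (Summable.sum_le_tsum _ (fun _ _ => pow_nonneg hr _)
    (summable_geometric_of_lt_one hr hr1)).trans_eq (tsum_geometric_of_lt_one hr hr1)

theorem geom_sum_range_reflect_le {r : ℝ} (hr : 0 ≤ r) (hr1 : r < 1) (k : ℕ) :
    ∑ t ∈ Finset.range k, r ^ (k - 1 - t) ≤ (1 - r)⁻¹ := by
  rw [Finset.sum_range_reflect (fun t => r ^ t) k]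
  exact geom_sum_range_le hr hr1 k

/-- Weighted Cauchy–Schwarz with weights `r^(k-1-t)`, whose sum is at most `(1-r)⁻¹`. The single
entry in row `i t` is then enlarged to the whole column deviation: `i t` is correlated with `g t`,
whereas the column depends only on later matrices. -/
theorem norm_sub_average_sq_le {n N : ℕ} (hn : n ≠ 0)
    {W : ℕ → Matrix (Fin n) (Fin n) ℝ} (hW : ∀ k, W k ∈ doublyStochastic ℝ (Fin n))
    {x : ℕ → Fin n → EuclideanSpace ℝ (Fin N)} {x₀ : EuclideanSpace ℝ (Fin N)} {γ : ℝ}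
    {i : ℕ → Fin n} {g : ℕ → EuclideanSpace ℝ (Fin N)} (h0 : ∀ j, x 0 j = x₀)
    (hstep : ∀ k j, x (k + 1) j = (∑ l, W k l j • x k l) - if j = i k then γ • g k else 0)
    {r : ℝ} (hr : 0 < r) (hr1 : r < 1) (k : ℕ) (j : Fin n) :
    ‖x k j - average (x k)‖ ^ 2 ≤ γ ^ 2 * ((1 - r)⁻¹ * ∑ t ∈ Finset.range k,
      (r ^ (k - 1 - t))⁻¹ * (‖g t‖ ^ 2 * colDeviation (mixing W (t + 1) (k - 1 - t)) j)) := by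
  rw [average_eq_sub_sum hn hW h0 hstep, eq_sub_sum_mixing hW h0 hstep, sub_sub_sub_cancel_left,
    ← smul_sub, ← Finset.sum_sub_distrib, norm_smul, mul_pow, Real.norm_eq_abs, sq_abs]
  simp_rw [← sub_smul]
  refine mul_le_mul_of_nonneg_left ?_ (sq_nonneg _)
  set c : ℕ → ℝ := fun t => (n : ℝ)⁻¹ - mixing W (t + 1) (k - 1 - t) (i t) j with hc
  have hrp : ∀ t, 0 < r ^ (k - 1 - t) := fun t => pow_pos hr _
  calc ‖∑ t ∈ Finset.range k, c t • g t‖ ^ 2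
      ≤ (∑ t ∈ Finset.range k, |c t| * ‖g t‖) ^ 2 := by
        gcongr
        refine (norm_sum_le _ _).trans_eq ?_
        simp [norm_smul]
    _ ≤ (∑ t ∈ Finset.range k, r ^ (k - 1 - t)) *
          ∑ t ∈ Finset.range k, (r ^ (k - 1 - t))⁻¹ * (|c t| * ‖g t‖) ^ 2 := by
        refine Finset.sum_sq_le_sum_mul_sum_of_sq_le_mul _ (fun t _ => (hrp t).le)
          (fun t _ => by have := hrp t; positivity) fun t _ => ?_
        rw [mul_inv_cancel_left₀ (hrp t).ne']
    _ ≤ _ := by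
        refine mul_le_mul (geom_sum_range_reflect_le hr.le hr1 k) ?_
          (Finset.sum_nonneg fun t _ => by have := hrp t; positivity) (by
            have : 0 < 1 - r := by linarith
            positivity)
        refine Finset.sum_le_sum fun t _ => ?_
        refine mul_le_mul_of_nonneg_left ?_ (inv_nonneg.2 (hrp t).le)
        rw [mul_pow, mul_comm, sq_abs]
        refine mul_le_mul_of_nonneg_left ?_ (sq_nonneg _)
        rw [hc, sub_sq_comm]
        exact Finset.single_le_sum (f := fun l => (mixing W (t + 1) (k - 1 - t) l j - (n : ℝ)⁻¹) ^ 2)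
          (fun _ _ => sq_nonneg _) (Finset.mem_univ (i t))

/-! ### Spectral gap on sum-zero vectors, and the descent lemma -/

/-- The vector `1` is fixed by `A`, while every eigenvalue after the largest is at most `ρ < 1`. So
`1` is orthogonal to all later eigenvectors and spans the first eigendirection; a vector of sum zero
then lives on the later ones. -/
theorem dotProduct_mulVec_le_of_eig {n : ℕ} (hn : 2 ≤ n) {A : Matrix (Fin n) (Fin n) ℝ}
    (hA : A.IsHermitian) (hA1 : A *ᵥ 1 = 1) {ρ : ℝ} (hρ : ρ < 1)
    (h : eig hA ⟨1, by omega⟩ ≤ ρ) {v : Fin n → ℝ} (hv : ∑ j, v j = 0) :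
    v ⬝ᵥ A *ᵥ v ≤ ρ * (v ⬝ᵥ v) := by
  have hsym := Matrix.isSymmetric_toEuclideanLin_iff.mpr hA
  have hfr : Module.finrank ℝ (EuclideanSpace ℝ (Fin n)) = Fintype.card (Fin n) :=
    finrank_euclideanSpace
  let b := hsym.eigenvectorBasis hfr
  have hc : Fintype.card (Fin n) = n := Fintype.card_fin n
  let z : Fin (Fintype.card (Fin n)) := Fin.cast hc.symm ⟨0, by omega⟩
  have heig : ∀ j, j ≠ z → hA.eigenvalues₀ j ≤ ρ := fun j hj => by
    refine (hA.eigenvalues₀_antitone (a := Fin.cast hc.symm ⟨1, by omega⟩) ?_).trans h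
    have : (j : ℕ) ≠ 0 := fun h0 => hj (Fin.ext h0)
    rw [Fin.le_def]
    simp only [Fin.val_cast]
    omega
  let u : EuclideanSpace ℝ (Fin n) := WithLp.toLp 2 1
  let v' : EuclideanSpace ℝ (Fin n) := WithLp.toLp 2 v
  have hb : ∀ j, Matrix.toEuclideanLin A (b j) = hA.eigenvalues₀ j • b j := fun j =>
    hsym.apply_eigenvectorBasis hfr j
  have hu : Matrix.toEuclideanLin A u = u := by
    simp [u, Matrix.toLpLin_apply, hA1]
  have hbu : ∀ j, j ≠ z → inner ℝ (b j) u = 0 := fun j hj => by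
    have h1 : inner ℝ (Matrix.toEuclideanLin A (b j)) u = inner ℝ (b j) u := by
      rw [hsym, hu]
    rw [hb, real_inner_smul_left] at h1
    have h2 := heig j hj
    have : (hA.eigenvalues₀ j - 1) * inner ℝ (b j) u = 0 := by linarith
    rcases mul_eq_zero.1 this with h3 | h3
    · linarith
    · exact h3
  have huv : inner ℝ u v' = 0 := by
    simp [u, v', PiLp.inner_apply, hv]
  have huz : u = inner ℝ (b z) u • b z := by
    conv_lhs => rw [← b.sum_repr' u]
    exact Finset.sum_eq_single z (fun j _ hj => by rw [hbu j hj, zero_smul]) (by simp)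
  have hu0 : u ≠ 0 := fun h0 => by
    have := congrArg (fun x : EuclideanSpace ℝ (Fin n) => x ⟨0, by omega⟩) h0
    simp [u] at this
  have hzv : inner ℝ (b z) v' = 0 := by
    rw [huz, real_inner_smul_left] at huv
    rcases mul_eq_zero.1 huv with h3 | h3
    · exact absurd (by rw [huz, h3, zero_smul]) hu0
    · exact h3
  have e1 : v ⬝ᵥ A *ᵥ v = inner ℝ v' (Matrix.toEuclideanLin A v') := by
    simp [v', Matrix.toLpLin_apply, PiLp.inner_apply, dotProduct, mul_comm]
  have e2 : v ⬝ᵥ v = inner ℝ v' v' := by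
    simp [v', PiLp.inner_apply, dotProduct, -inner_self_eq_norm_sq_to_K]
  rw [e1, e2, ← b.sum_inner_mul_inner, ← b.sum_inner_mul_inner, Finset.mul_sum]
  refine Finset.sum_le_sum fun j _ => ?_
  rw [← hsym, hb, real_inner_smul_left, real_inner_comm]
  by_cases hj : j = z
  · simp [hj, hzv]
  · nlinarith [heig j hj, mul_self_nonneg (inner ℝ (b j) v')]

/-- The function `φ`, the restriction of `f` to the segment minus its quadratic upper model, has
nonpositive derivative there by the Lipschitz bound and Cauchy–Schwarz. -/
theorem descent_lemma {E : Type*} [NormedAddCommGroup E] [InnerProductSpace ℝ E] [CompleteSpace E]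
    {f : E → ℝ} (hf : Differentiable ℝ f) {L : ℝ≥0} (hL : LipschitzWith L (gradient f)) (x y : E) :
    f y ≤ f x + inner ℝ (gradient f x) (y - x) + L / 2 * ‖y - x‖ ^ 2 := by
  set d := y - x with hd
  let φ : ℝ → ℝ := fun t => f (x + t • d) - t * inner ℝ (gradient f x) d - L / 2 * ‖d‖ ^ 2 * t ^ 2
  have hφ : ∀ t, HasDerivAt φ (inner ℝ (gradient f (x + t • d)) d - inner ℝ (gradient f x) d -
      L * ‖d‖ ^ 2 * t) t := fun t => by
    have h1 : HasDerivAt (fun t : ℝ => x + t • d) d t := by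
      simpa using ((hasDerivAt_id t).smul_const d).const_add x
    have h2 := (hf (x + t • d)).hasGradientAt.hasFDerivAt.comp_hasDerivAt t h1
    refine ((h2.sub ((hasDerivAt_id t).mul_const _)).sub
      ((hasDerivAt_pow 2 t).const_mul (L / 2 * ‖d‖ ^ 2))).congr_deriv ?_
    simp
    ring
  have hanti : AntitoneOn φ (Set.Icc 0 1) := by
    refine antitoneOn_of_deriv_nonpos (convex_Icc 0 1)
      (fun t _ => (hφ t).continuousAt.continuousWithinAt)
      (fun t _ => (hφ t).differentiableAt.differentiableWithinAt) fun t ht => ?_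
    rw [interior_Icc] at ht
    rw [(hφ t).deriv, ← inner_sub_left]
    have h1 := real_inner_le_norm (gradient f (x + t • d) - gradient f x) d
    have h2 : ‖gradient f (x + t • d) - gradient f x‖ ≤ L * (t * ‖d‖) := by
      have := hL.norm_sub_le (x + t • d) x
      rwa [add_sub_cancel_left, norm_smul, Real.norm_of_nonneg ht.1.le] at this
    nlinarith [norm_nonneg d, mul_le_mul_of_nonneg_right h2 (norm_nonneg d)]
  have := hanti (Set.left_mem_Icc.2 zero_le_one) (Set.right_mem_Icc.2 zero_le_one) zero_le_one
  simp only [φ, hd, one_smul, zero_smul, add_zero, add_sub_cancel, one_mul, zero_mul, one_pow,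
    mul_one, sub_zero, ne_eq, OfNat.ofNat_ne_zero, not_false_eq_true, zero_pow, mul_zero] at this ⊢
  linarith

/-! ### Sums over delayed indices -/

/-- After exchanging the sums, a fixed `t` lies only in windows with `t < k ≤ t + T`, hence in at
most `T` of them. -/
theorem sum_window_le {τ : ℕ → ℕ} {T : ℕ} (hτ : ∀ k, τ k ≤ T) {a : ℕ → ℝ} (ha : ∀ k, 0 ≤ a k)
    (K : ℕ) : ∑ k ∈ Finset.range K, ∑ t ∈ Finset.Ico (k - τ k) k, a t ≤
      T * ∑ t ∈ Finset.range K, a t := by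
  rw [Finset.sum_comm' (t' := Finset.range K)
    (s' := fun t => {k ∈ Finset.range K | k - τ k ≤ t ∧ t < k}), Finset.mul_sum]
  · refine Finset.sum_le_sum fun t _ => ?_
    rw [Finset.sum_const, nsmul_eq_mul]
    refine mul_le_mul_of_nonneg_right ?_ (ha t)
    have h1 : {k ∈ Finset.range K | k - τ k ≤ t ∧ t < k} ⊆ Finset.Ioc t (t + T) := fun k hk => by
      simp only [Finset.mem_filter, Finset.mem_Ioc] at hk ⊢
      have := hτ k
      omega
    have := Finset.card_le_card h1
    rw [Nat.card_Ioc] at this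
    exact_mod_cast this.trans_eq (by omega)
  · intro k t
    simp only [Finset.mem_range, Finset.mem_Ico, Finset.mem_filter]
    omega

theorem sum_pow_truncated_le {r : ℝ} (hr : 0 ≤ r) (hr1 : r < 1) (T K : ℕ) :
    ∑ s ∈ Finset.range K, r ^ (s - T) ≤ T + (1 - r)⁻¹ := by
  have h1 : ∑ s ∈ Finset.range K, r ^ (s - T) ≤ ∑ s ∈ Finset.range (T + K), r ^ (s - T) :=
    Finset.sum_le_sum_of_subset_of_nonneg (Finset.range_subset_range.2 (by omega))
      fun _ _ _ => pow_nonneg hr _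
  rw [Finset.sum_range_add] at h1
  have h2 : ∑ s ∈ Finset.range T, r ^ (s - T) = T := by
    rw [Finset.sum_congr rfl fun s hs => by
      rw [Nat.sub_eq_zero_of_le (Finset.mem_range.1 hs).le, pow_zero]]
    simp
  simp only [h2, add_tsub_cancel_left] at h1
  linarith [geom_sum_range_le hr hr1 K]

/-- Different `k` may share the same delayed index `k - τ k`, so the plain geometric bound fails.
For fixed `t` the exponent is at least `k - (t+1) - T`, truncated at zero: at most `T` terms are
bounded by one and the others form a geometric series. -/
theorem sum_delayed_geometric_le {τ : ℕ → ℕ} {T : ℕ} (hτ : ∀ k, τ k ≤ T) {r : ℝ} (hr : 0 ≤ r)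
    (hr1 : r < 1) {b : ℕ → ℝ} (hb : ∀ k, 0 ≤ b k) (K : ℕ) :
    ∑ k ∈ Finset.range K, ∑ t ∈ Finset.range (k - τ k), r ^ (k - τ k - 1 - t) * b t ≤
      (T + (1 - r)⁻¹) * ∑ t ∈ Finset.range K, b t := by
  rw [Finset.sum_comm' (t' := Finset.range K)
    (s' := fun t => {k ∈ Finset.range K | t < k - τ k}), Finset.mul_sum]
  · refine Finset.sum_le_sum fun t _ => ?_
    rw [← Finset.sum_mul]
    refine mul_le_mul_of_nonneg_right ?_ (hb t)
    calc ∑ k ∈ Finset.range K with t < k - τ k, r ^ (k - τ k - 1 - t)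
        ≤ ∑ k ∈ Finset.range K with t < k - τ k, r ^ (k - (t + 1) - T) := by
          refine Finset.sum_le_sum fun k hk => pow_le_pow_of_le_one hr hr1.le ?_
          have := hτ k
          simp only [Finset.mem_filter] at hk
          omega
      _ ≤ ∑ k ∈ Finset.Ico (t + 1) (t + 1 + K), r ^ (k - (t + 1) - T) := by
          refine Finset.sum_le_sum_of_subset_of_nonneg (fun k hk => ?_)
            fun _ _ _ => pow_nonneg hr _
          simp only [Finset.mem_filter, Finset.mem_range, Finset.mem_Ico] at hk ⊢
          omega
      _ = ∑ s ∈ Finset.range K, r ^ (s - T) := by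
          rw [Finset.sum_Ico_eq_sum_range]
          simp
      _ ≤ _ := sum_pow_truncated_le hr hr1 T K
  · intro k t
    simp only [Finset.mem_range, Finset.mem_filter]
    omega

/-! ### Closing the system of recursions -/

/-- The arithmetic behind the convergence rate, for sums over the iterations of the expected squared
norms of the true gradients (`S`), the mean update directions (`H`), the stochastic gradients (`A`),
the consensus errors (`Q`), and the errors of the mean directions (`D`). -/
theorem sum_grad_le_of_recursions {S H D A Q R K n M T L γ v s κ w : ℝ}
    (hn : 0 < n) (hM : 0 < M) (hL : 0 ≤ L) (hγ : 0 < γ) (hH : 0 ≤ H) (hQ : 0 ≤ Q) (hK : 0 ≤ K)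
    (hκ : 0 ≤ κ) (hv : 0 ≤ v) (hvs : v ≤ M * s)
    (h1 : S + H ≤ R + D + γ * L / (n * M) * A)
    (h2 : D ≤ 2 * L ^ 2 * (γ ^ 2 / n ^ 2) * (T * (T * A)) + 2 * L ^ 2 * Q)
    (h3 : A ≤ K * v + M ^ 2 * H + 2 * M ^ 2 * L ^ 2 * Q)
    (h4 : Q ≤ γ ^ 2 * (κ * (w ^ 2 * (K * v) +
      w * (T + w) * (M ^ 2 * H + 2 * M ^ 2 * L ^ 2 * Q))))
    (hδ1 : 10 * (γ * L * M) ≤ n) (hδ2 : 8 * (γ * L * M) * T ^ 2 ≤ n)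
    (hδ3 : 8 * n * (κ * w ^ 2) * (γ * L * M) ≤ 1)
    (hδ4 : 32 * (γ * L * M) ^ 2 * (κ * (w * (T + w))) ≤ 1) :
    S ≤ R + 2 * γ * L / n * s * K := by
  set δ := γ * L * M with hδ
  have hδ0 : 0 ≤ δ := by positivity
  have hL2Q : 0 ≤ L ^ 2 * Q := by positivity
  have hs : 0 ≤ s := by
    by_contra hs
    nlinarith
  -- `P` is the part of `L² Q` caused by the constant noise level `v`; the rest is feedback from `H`
  -- and `Q`.
  set P := γ ^ 2 * L ^ 2 * (κ * w ^ 2) * (K * v) with hP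
  have h5 : L ^ 2 * Q ≤ P + 1 / 32 * (H + 2 * (L ^ 2 * Q)) := by
    have e := mul_le_mul_of_nonneg_left h4 (sq_nonneg L)
    have e2 : L ^ 2 * (γ ^ 2 * (κ * (w ^ 2 * (K * v) +
      w * (T + w) * (M ^ 2 * H + 2 * M ^ 2 * L ^ 2 * Q)))) =
      P + (δ ^ 2 * (κ * (w * (T + w)))) * (H + 2 * (L ^ 2 * Q)) := by
      rw [hP, hδ]; ring
    rw [e2] at e
    refine e.trans ?_
    gcongr
    linarith
  have h6 : P ≤ γ * L / n * s * K * (1 / 8) := by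
    have e1 : P ≤ γ ^ 2 * L ^ 2 * (κ * w ^ 2) * (K * (M * s)) := by
      rw [hP]; gcongr
    have e2 : γ ^ 2 * L ^ 2 * (κ * w ^ 2) * (K * (M * s)) =
        γ * L / n * s * K * (1 / 8) * (8 * n * (κ * w ^ 2) * δ) := by
      rw [hδ]; field_simp
    rw [e2] at e1
    exact e1.trans (mul_le_of_le_one_right (by positivity) hδ3)
  -- `c` is the total coefficient of `A` once the bound on `D` is inserted into the descent
  -- inequality.
  set c := 2 * L ^ 2 * γ ^ 2 * T ^ 2 / n ^ 2 + γ * L / (n * M) with hc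
  have hc0 : 0 ≤ c := by positivity
  -- The bound is attained by the two conditions on `δ`: `2 · 1/10 · 1/8 + 1/10 = 1/8`.
  have h7 : c * M ^ 2 ≤ 1 / 8 := by
    have e1 : c * M ^ 2 = 2 * (δ / n) * (δ * T ^ 2 / n) + δ / n := by
      rw [hc, hδ]; field_simp
    have e2 : δ / n ≤ 1 / 10 := by rw [div_le_iff₀ hn]; linarith
    have e3 : δ * T ^ 2 / n ≤ 1 / 8 := by rw [div_le_iff₀ hn]; linarith
    have e4 : 0 ≤ δ / n := by positivity
    have e5 : 0 ≤ δ * T ^ 2 / n := by positivity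
    rw [e1]
    nlinarith
  have h8 : c * (K * v) ≤ γ * L / n * s * K * (5 / 4) := by
    have e1 : c * (K * v) ≤ c * (K * (M * s)) := by gcongr
    have e2 : c * (K * (M * s)) = γ * L / n * s * K * (2 * (δ * T ^ 2 / n) + 1) := by
      rw [hc, hδ]; field_simp
    have e3 : δ * T ^ 2 / n ≤ 1 / 8 := by rw [div_le_iff₀ hn]; linarith
    rw [e2] at e1
    refine e1.trans ?_
    gcongr
    linarith
  have h9 : S + H ≤ R + 2 * (L ^ 2 * Q) + c * A := by
    have : c * A = 2 * L ^ 2 * (γ ^ 2 / n ^ 2) * (T * (T * A)) + γ * L / (n * M) * A := by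
      rw [hc]; ring
    linarith
  have h10 : c * A ≤ c * (K * v) + c * M ^ 2 * (H + 2 * (L ^ 2 * Q)) := by
    have := mul_le_mul_of_nonneg_left h3 hc0
    linarith
  have h11 : c * M ^ 2 * (H + 2 * (L ^ 2 * Q)) ≤ 1 / 8 * (H + 2 * (L ^ 2 * Q)) :=
    mul_le_mul_of_nonneg_right h7 (by linarith)
  have h12 : 0 ≤ γ * L / n * s * K := by positivity
  have h13 : 2 * γ * L / n * s * K = 2 * (γ * L / n * s * K) := by ring
  rw [h13]
  -- With `E = γLsK/n` and `q = L²Q`, the bounds combine to `S + (7/8) H ≤ R + (9/4) q + (5/4) E`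
  -- and `(15/16) q ≤ E/8 + H/32`. Eliminating `q` leaves `1.55 E` on the right, and the `H` terms
  -- are absorbed on the left.
  linarith

/-- Here `e` is the expected objective at the average model, so its decrements telescope; the other
sequences are the stepwise versions of the five sums. -/
theorem sum_grad_le {n M T K : ℕ} {τ : ℕ → ℕ} (hτ : ∀ k, τ k ≤ T) {L γ v s κ r f₀ f_min : ℝ}
    {e S H D A Q : ℕ → ℝ} (hn : 0 < (n : ℝ)) (hM : 0 < (M : ℝ)) (hL : 0 ≤ L) (hγ : 0 < γ)
    (hr : 0 < r) (hr1 : r < 1)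
    (hH : ∀ k, 0 ≤ H k) (hA : ∀ k, 0 ≤ A k) (hQ : ∀ k, 0 ≤ Q k)
    (hκ : 0 ≤ κ) (hv : 0 ≤ v) (hvs : v ≤ M * s) (he0 : e 0 = f₀) (heK : f_min ≤ e K)
    (h1 : ∀ k, e (k + 1) ≤ e k - γ * M / (2 * n) * (S k + H k) + γ * M / (2 * n) * D k +
      γ ^ 2 * L / (2 * n ^ 2) * A k)
    (h2 : ∀ k, D k ≤ 2 * L ^ 2 * (γ ^ 2 / n ^ 2) * (T * ∑ t ∈ Finset.Ico (k - τ k) k, A t) +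
      2 * L ^ 2 * Q k)
    (h3 : ∀ k, A k ≤ v + M ^ 2 * H k + 2 * M ^ 2 * L ^ 2 * Q k)
    (h4 : ∀ k, Q k ≤ γ ^ 2 * (κ * ((1 - r)⁻¹ *
      ∑ t ∈ Finset.range (k - τ k), r ^ (k - τ k - 1 - t) * A t)))
    (hδ1 : 10 * (γ * L * M) ≤ n) (hδ2 : 8 * (γ * L * M) * T ^ 2 ≤ n)
    (hδ3 : 8 * n * (κ * (1 - r)⁻¹ ^ 2) * (γ * L * M) ≤ 1)
    (hδ4 : 32 * (γ * L * M) ^ 2 * (κ * ((1 - r)⁻¹ * (T + (1 - r)⁻¹))) ≤ 1) :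
    ∑ k ∈ Finset.range K, S k ≤ 2 * n * (f₀ - f_min) / (γ * M) + 2 * γ * L / n * s * K := by
  set w := (1 - r)⁻¹ with hw
  have hw0 : 0 < w := inv_pos.2 (by linarith)
  refine sum_grad_le_of_recursions (S := ∑ k ∈ Finset.range K, S k)
    (H := ∑ k ∈ Finset.range K, H k) (D := ∑ k ∈ Finset.range K, D k)
    (A := ∑ k ∈ Finset.range K, A k) (Q := ∑ k ∈ Finset.range K, Q k) hn hM hL hγ
    (Finset.sum_nonneg fun k _ => hH k) (Finset.sum_nonneg fun k _ => hQ k) K.cast_nonneg hκ hv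
    hvs ?_ ?_ ?_ ?_ hδ1 hδ2 hδ3 hδ4
  · have e1 : ∀ k, S k + H k ≤ 2 * n / (γ * M) * (e k - e (k + 1)) + D k +
        γ * L / (n * M) * A k := fun k => by
      have := mul_le_mul_of_nonneg_left (h1 k) (by positivity : 0 ≤ 2 * n / (γ * M))
      have e2 : 2 * n / (γ * M) * (e k - γ * M / (2 * n) * (S k + H k) + γ * M / (2 * n) * D k +
          γ ^ 2 * L / (2 * n ^ 2) * A k) = 2 * n / (γ * M) * e k - (S k + H k) + D k +
          γ * L / (n * M) * A k := by
        field_simp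
      rw [e2] at this
      linarith
    have e3 := Finset.sum_le_sum fun k (_ : k ∈ Finset.range K) => e1 k
    simp only [Finset.sum_add_distrib, ← Finset.mul_sum, Finset.sum_range_sub'] at e3
    refine e3.trans ?_
    have : 2 * n / (γ * M) * (e 0 - e K) ≤ 2 * n * (f₀ - f_min) / (γ * M) := by
      rw [he0, mul_div_right_comm (2 * (n : ℝ))]
      gcongr
    linarith
  · have e3 := Finset.sum_le_sum fun k (_ : k ∈ Finset.range K) => h2 k
    simp only [Finset.sum_add_distrib, ← Finset.mul_sum] at e3
    refine e3.trans ?_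
    gcongr
    exact sum_window_le hτ hA K
  · have e3 := Finset.sum_le_sum fun k (_ : k ∈ Finset.range K) => h3 k
    simpa [Finset.sum_add_distrib, ← Finset.mul_sum] using e3
  -- The constant `v` is separated from the varying part `b`. It is summed by a plain geometric
  -- series within each step, so the delay factor `T + w` falls only on `b`.
  · set b : ℕ → ℝ := fun k => M ^ 2 * H k + 2 * M ^ 2 * L ^ 2 * Q k with hb
    have hb0 : ∀ k, 0 ≤ b k := fun k => by
      have := hH k
      have := hQ k
      positivity
    have e1 : ∀ k, Q k ≤ γ ^ 2 * (κ * (w * (w * v +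
        ∑ t ∈ Finset.range (k - τ k), r ^ (k - τ k - 1 - t) * b t))) := fun k => by
      refine (h4 k).trans ?_
      gcongr
      calc ∑ t ∈ Finset.range (k - τ k), r ^ (k - τ k - 1 - t) * A t
          ≤ ∑ t ∈ Finset.range (k - τ k), (r ^ (k - τ k - 1 - t) * v +
              r ^ (k - τ k - 1 - t) * b t) := by
            refine Finset.sum_le_sum fun t _ => ?_
            rw [← mul_add]
            refine mul_le_mul_of_nonneg_left ?_ (pow_nonneg hr.le _)
            linarith [h3 t]
        _ ≤ _ := by
            rw [Finset.sum_add_distrib, ← Finset.sum_mul]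
            gcongr
            exact geom_sum_range_reflect_le hr.le hr1 _
    have e3 := Finset.sum_le_sum fun k (_ : k ∈ Finset.range K) => e1 k
    simp only [Finset.sum_add_distrib, ← Finset.mul_sum, Finset.sum_const, Finset.card_range,
      nsmul_eq_mul] at e3
    refine e3.trans ?_
    have e4 := sum_delayed_geometric_le hτ hr.le hr1 hb0 K
    have e5 : ∑ t ∈ Finset.range K, b t = M ^ 2 * ∑ k ∈ Finset.range K, H k +
        2 * M ^ 2 * L ^ 2 * ∑ k ∈ Finset.range K, Q k := by
      simp [hb, Finset.sum_add_distrib, ← Finset.mul_sum]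
    rw [← e5]
    have e6 : w ^ 2 * (K * v) + w * (T + w) * ∑ t ∈ Finset.range K, b t =
        w * (w * (K * v) + (T + w) * ∑ t ∈ Finset.range K, b t) := by ring
    rw [e6]
    gcongr

/-! ### Consequences of the step size and the iteration threshold -/

/-- The step size conditions that `iterationThreshold` guarantees. -/
theorem stepSize_mul_le {n M T K : ℕ} (hn : 0 < n) (hM : 0 < M) (hK : 0 < K) {L σ ς ρ γ : ℝ}
    (hL : 0 ≤ L) (hσς : 0 < σ ^ 2 + 6 * M * ς ^ 2)
    (hγ : γ = n / (10 * M * L + √(σ ^ 2 + 6 * M * ς ^ 2) * √(K * M)))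
    (hK_large : iterationThreshold n M T L σ ς ρ ≤ K) :
    0 < γ ∧ 10 * (γ * L * M) ≤ n ∧ γ * (√(σ ^ 2 + 6 * M * ς ^ 2) * √(K * M)) ≤ n ∧
      8 * (γ * L * M) * T ^ 2 ≤ n ∧ 32 * n * rhoBar n ρ * (γ * L * M) ≤ 1 := by
  have hn' : (0 : ℝ) < n := by exact_mod_cast hn
  have hM' : (0 : ℝ) < M := by exact_mod_cast hM
  have hK' : (0 : ℝ) < K := by exact_mod_cast hK
  set V := σ ^ 2 + 6 * M * ς ^ 2 with hV
  have hsV : 0 < √V := Real.sqrt_pos.2 hσς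
  have hsKM : 0 < √(K * M) := Real.sqrt_pos.2 (by positivity)
  have hden : 0 < 10 * M * L + √V * √(K * M) := by positivity
  have hγ0 : 0 < γ := by rw [hγ]; positivity
  have hγd : γ * (10 * M * L + √V * √(K * M)) = n := by
    rw [hγ]; field_simp
  have hγs : γ * (√V * √(K * M)) ≤ n := by
    have : 0 ≤ γ * (10 * M * L) := by positivity
    linarith
  -- Since `γ ≤ n / (√V √(KM))`, a lower bound on `K` quadratic in `y` gives a linear bound on
  -- `γLMy`. The entries `64 T⁴/n²` and `1024 n² ρ̄²` of the maximum are the squares of the two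
  -- values of `y` used below.
  have key : ∀ y : ℝ, M * L ^ 2 * n ^ 2 / V * y ^ 2 ≤ K → γ * L * M * y ≤ 1 := fun y hy => by
    have h1 : n * (L * M * y) ≤ √V * √(K * M) := by
      rw [← Real.sqrt_mul hσς.le]
      refine Real.le_sqrt_of_sq_le ?_
      have h2 : M * L ^ 2 * n ^ 2 / V * y ^ 2 * (V * M) ≤ K * (V * M) := by gcongr
      have h3 : M * L ^ 2 * n ^ 2 / V * y ^ 2 * (V * M) = (n * (L * M * y)) ^ 2 := by
        field_simp
      linarith
    have h4 : n * (γ * L * M * y) ≤ n * 1 := by nlinarith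
    exact le_of_mul_le_mul_left h4 hn'
  have hpre : 0 ≤ M * L ^ 2 * n ^ 2 / V := by positivity
  unfold iterationThreshold at hK_large
  rw [← hV] at hK_large
  refine ⟨hγ0, ?_, hγs, ?_, ?_⟩
  · have : 0 ≤ γ * (√V * √(K * M)) := by positivity
    linarith
  · have := key (8 * T ^ 2 / n) (le_trans (mul_le_mul_of_nonneg_left ?_ hpre) hK_large)
    · rw [← mul_div_assoc, div_le_one hn'] at this
      linarith
    · refine le_trans (le_of_eq ?_) ((le_max_left _ _).trans (le_max_right _ _))
      ring
  · have := key (32 * n * rhoBar n ρ) (le_trans (mul_le_mul_of_nonneg_left ?_ hpre) hK_large)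
    · linarith
    · refine le_trans (le_of_eq ?_) ((le_max_left _ _).trans
        ((le_max_right _ _).trans (le_max_right _ _)))
      ring

/-- With `y = √ρ`, the left factor is `4/(1-y)²`, and the bracket in `ρ̄` exceeds `1/(1-y)²` by
`2y²/((1+y)(1-y)²)`. -/
theorem inv_one_sub_sq_le_rhoBar {n : ℕ} (hn : 0 < n) {ρ : ℝ} (hρ : 0 ≤ ρ) (hρ1 : ρ < 1) :
    ((n : ℝ) - 1) / n * (1 - (1 + √ρ) / 2)⁻¹ ^ 2 ≤ 4 * rhoBar n ρ := by
  have hn' : (1 : ℝ) ≤ n := by exact_mod_cast hn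
  have hs0 := Real.sqrt_nonneg ρ
  have hs1 : √ρ < 1 := by rw [Real.sqrt_lt' one_pos]; linarith
  have hρs : ρ = √ρ ^ 2 := (Real.sq_sqrt hρ).symm
  unfold rhoBar
  have h1 : (1 - (1 + √ρ) / 2)⁻¹ ^ 2 ≤ 4 * (1 / (1 - ρ) + 2 * √ρ / (1 - √ρ) ^ 2) := by
    set y := √ρ with hy
    rw [hρs]
    have h2 : 0 < 1 - y := by linarith
    have h3 : (1 - (1 + y) / 2)⁻¹ ^ 2 = 4 * (1 / (1 - y) ^ 2) := by
      have : 1 - (1 + y) / 2 = (1 - y) / 2 := by ring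
      rw [this]; field_simp; norm_num
    have h4 : 1 / (1 - y ^ 2) = (1 - y) / ((1 + y) * (1 - y) ^ 2) := by
      have : 1 - y ^ 2 = (1 + y) * (1 - y) := by ring
      rw [this]; field_simp
    rw [h3, h4]
    have h5 : (1 - y) / ((1 + y) * (1 - y) ^ 2) + 2 * y / (1 - y) ^ 2 - 1 / (1 - y) ^ 2 =
        2 * y ^ 2 / ((1 + y) * (1 - y) ^ 2) := by
      field_simp; ring
    have h6 : 0 ≤ 2 * y ^ 2 / ((1 + y) * (1 - y) ^ 2) := by positivity
    linarith
  have h2 : 0 ≤ ((n : ℝ) - 1) / n := div_nonneg (by linarith) (by linarith)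
  calc _ ≤ ((n : ℝ) - 1) / n * (4 * (1 / (1 - ρ) + 2 * √ρ / (1 - √ρ) ^ 2)) := by gcongr
    _ = _ := by ring

/-- The mixed term `δTw` is the geometric mean of `δT²` and `δw²`, both already controlled. For `n =
1` the factor `n - 1` vanishes; for `n ≥ 2` the second condition also forces `8δ ≤ 1`. -/
theorem stepSize_sq_mul_le {n : ℕ} (hn : 0 < n) {δ T w : ℝ} (hδ : 0 ≤ δ) (hw : 1 ≤ w)
    (h1 : 8 * δ * T ^ 2 ≤ n) (h2 : 8 * n * (((n : ℝ) - 1) / n * w ^ 2) * δ ≤ 1) :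
    32 * δ ^ 2 * (((n : ℝ) - 1) / n * (w * (T + w))) ≤ 1 := by
  rcases Nat.lt_or_ge n 2 with h | h
  · obtain rfl : n = 1 := by omega
    simp
  have hn' : (2 : ℝ) ≤ n := by exact_mod_cast h
  set κ := ((n : ℝ) - 1) / n with hκ
  have hκ0 : 0 ≤ κ := div_nonneg (by linarith) (by linarith)
  have hκ1 : κ ≤ 1 := by rw [hκ, div_le_one (by linarith)]; linarith
  have hnκ : n * κ = n - 1 := by rw [hκ]; field_simp
  have hw2 : 1 ≤ w ^ 2 := one_le_pow₀ hw
  have h3 : 8 * (n - 1) * (w ^ 2 * δ) ≤ 1 := by rw [← hnκ]; linarith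
  have h4 : δ ≤ w ^ 2 * δ := le_mul_of_one_le_left hδ hw2
  have h5 : 8 * δ ≤ 1 := by nlinarith
  have h6 : 8 * (κ * (w ^ 2 * δ)) ≤ 1 := by nlinarith
  have h7 : 8 * (κ * (δ * (T * w))) ≤ 1 := by
    have e1 : (8 * (κ * (δ * (T * w)))) ^ 2 ≤ 1 := by
      have e2 : (8 * (κ * (δ * (T * w)))) ^ 2 =
          κ * ((8 * δ * T ^ 2) * (8 * κ * w ^ 2 * δ)) := by ring
      have e3 : (8 * δ * T ^ 2) * (8 * κ * w ^ 2 * δ) ≤ n * (8 * κ * w ^ 2 * δ) :=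
        mul_le_mul_of_nonneg_right h1 (by positivity)
      have e4 : 0 ≤ (8 * δ * T ^ 2) * (8 * κ * w ^ 2 * δ) := by positivity
      rw [e2]
      nlinarith
    exact (abs_le_one_iff_mul_self_le_one.2 (by nlinarith) |> abs_le.1).2
  have e : 32 * δ ^ 2 * (κ * (w * (T + w))) =
      (8 * δ) / 2 * (8 * (κ * (δ * (T * w))) + 8 * (κ * (w ^ 2 * δ))) := by ring
  rw [e]
  nlinarith

/-! ### Measurability of the iterates and of the mixing products -/

theorem measurable_apply_of_finite {Ω α β : Type*} [MeasurableSpace Ω] [MeasurableSpace α]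
    [MeasurableSpace β] [Countable α] [MeasurableSingletonClass α] {i : Ω → α} (hi : Measurable i)
    {f : α → Ω → β} (hf : ∀ a, Measurable (f a)) : Measurable fun ω => f (i ω) ω :=
  (measurable_from_prod_countable_left (f := fun q : Ω × α => f q.2 q.1) hf).comp
    (measurable_id.prodMk hi)

/-- The sum of the stochastic gradients that AD-PSGD evaluates at step `k`. -/
noncomputable def batchGrad {n N M : ℕ} {Z : Type*}
    (F : Fin n → EuclideanSpace ℝ (Fin N) → Z → ℝ) (x₀ : EuclideanSpace ℝ (Fin N)) (γ : ℝ)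
    (τ : ℕ → ℕ) (i : ℕ → Fin n) (W : ℕ → Matrix (Fin n) (Fin n) ℝ) (z : ℕ → Fin M → Z) (k : ℕ) :
    EuclideanSpace ℝ (Fin N) :=
  ∑ m, sampleGrad (F (i k)) (iterate F x₀ γ τ i W z (k - τ k) (i k)) (z k m)

theorem iterate_zero {n N M : ℕ} {Z : Type*}
    (F : Fin n → EuclideanSpace ℝ (Fin N) → Z → ℝ) (x₀ : EuclideanSpace ℝ (Fin N)) (γ : ℝ)
    (τ : ℕ → ℕ) (i : ℕ → Fin n) (W : ℕ → Matrix (Fin n) (Fin n) ℝ) (z : ℕ → Fin M → Z)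
    (j : Fin n) : iterate F x₀ γ τ i W z 0 j = x₀ := by
  rw [iterate]

theorem iterate_succ {n N M : ℕ} {Z : Type*}
    (F : Fin n → EuclideanSpace ℝ (Fin N) → Z → ℝ) (x₀ : EuclideanSpace ℝ (Fin N)) (γ : ℝ)
    (τ : ℕ → ℕ) (i : ℕ → Fin n) (W : ℕ → Matrix (Fin n) (Fin n) ℝ) (z : ℕ → Fin M → Z)
    (k : ℕ) (j : Fin n) : iterate F x₀ γ τ i W z (k + 1) j =
      (∑ l, W k l j • iterate F x₀ γ τ i W z k l) -
        if j = i k then γ • batchGrad F x₀ γ τ i W z k else 0 := by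
  rw [iterate, batchGrad]

theorem measurable_batch_of_iterate {n N M : ℕ} {Z Ω : Type*} [MeasurableSpace Z]
    [MeasurableSpace Ω] {F : Fin n → EuclideanSpace ℝ (Fin N) → Z → ℝ}
    (hF : ∀ a, Measurable fun q : EuclideanSpace ℝ (Fin N) × Z => sampleGrad (F a) q.1 q.2)
    {x : Fin n → Ω → EuclideanSpace ℝ (Fin N)} {i : Ω → Fin n} {ξ : Ω → Fin M → Z}
    (hx : ∀ a, Measurable (x a)) (hi : Measurable i) (hξ : Measurable ξ) :
    Measurable fun ω => ∑ m, sampleGrad (F (i ω)) (x (i ω) ω) (ξ ω m) :=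
  measurable_apply_of_finite hi (f := fun a ω => ∑ m, sampleGrad (F a) (x a ω) (ξ ω m))
    fun a => Finset.measurable_sum _ fun m _ =>
      (hF a).comp ((hx a).prodMk ((measurable_pi_apply m).comp hξ))

theorem measurable_matrix_apply {Ω : Type*} [MeasurableSpace Ω] {n : ℕ}
    {W : Ω → Matrix (Fin n) (Fin n) ℝ} (hW : Measurable W) (a b : Fin n) :
    Measurable fun ω => W ω a b :=
  (measurable_pi_apply b).comp ((measurable_pi_apply (X := fun _ => Fin n → ℝ) a).comp hW)

theorem measurable_iterate {n N M : ℕ} {Z Ω : Type*} [MeasurableSpace Z] [MeasurableSpace Ω]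
    {F : Fin n → EuclideanSpace ℝ (Fin N) → Z → ℝ}
    (hF : ∀ a, Measurable fun q : EuclideanSpace ℝ (Fin N) × Z => sampleGrad (F a) q.1 q.2)
    {x₀ : EuclideanSpace ℝ (Fin N)} {γ : ℝ} {τ : ℕ → ℕ}
    {i : ℕ → Ω → Fin n} {W : ℕ → Ω → Matrix (Fin n) (Fin n) ℝ} {ξ : ℕ → Ω → Fin M → Z} (k : ℕ)
    (hi : ∀ j < k, Measurable (i j)) (hW : ∀ j < k, Measurable (W j))
    (hξ : ∀ j < k, Measurable (ξ j)) (j : Fin n) :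
    Measurable fun ω => iterate F x₀ γ τ (i · ω) (W · ω) (ξ · ω) k j := by
  induction k using Nat.strong_induction_on generalizing j with
  | _ k ih =>
    cases k with
    | zero => simp_rw [iterate_zero]; exact measurable_const
    | succ k =>
      have ih' : ∀ k' ≤ k, ∀ j, Measurable fun ω =>
          iterate F x₀ γ τ (i · ω) (W · ω) (ξ · ω) k' j := fun k' hk' j =>
        ih k' (by omega) (fun a ha => hi a (by omega)) (fun a ha => hW a (by omega))
          (fun a ha => hξ a (by omega)) j
      simp_rw [iterate_succ]
      refine (Finset.measurable_sum _ fun l _ =>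
        (measurable_matrix_apply (hW k (by omega)) l j).smul (ih' k le_rfl l)).sub ?_
      refine Measurable.ite ?_ ((measurable_batch_of_iterate hF (fun a => ih' _ (by omega) a)
        (hi k (by omega)) (hξ k (by omega))).const_smul γ) measurable_const
      have : {ω | j = i k ω} = i k ⁻¹' {j} := by ext; simp [eq_comm]
      rw [this]
      exact hi k (by omega) (measurableSet_singleton j)

theorem measurable_batchGrad {n N M : ℕ} {Z Ω : Type*} [MeasurableSpace Z] [MeasurableSpace Ω]
    {F : Fin n → EuclideanSpace ℝ (Fin N) → Z → ℝ}
    (hF : ∀ a, Measurable fun q : EuclideanSpace ℝ (Fin N) × Z => sampleGrad (F a) q.1 q.2)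
    {x₀ : EuclideanSpace ℝ (Fin N)} {γ : ℝ} {τ : ℕ → ℕ}
    {i : ℕ → Ω → Fin n} {W : ℕ → Ω → Matrix (Fin n) (Fin n) ℝ} {ξ : ℕ → Ω → Fin M → Z} (k : ℕ)
    (hi : ∀ j < k + 1, Measurable (i j)) (hW : ∀ j < k + 1, Measurable (W j))
    (hξ : ∀ j < k + 1, Measurable (ξ j)) :
    Measurable fun ω => batchGrad F x₀ γ τ (i · ω) (W · ω) (ξ · ω) k :=
  measurable_batch_of_iterate hF
    (fun a => measurable_iterate hF _ (fun j hj => hi j (by omega)) (fun j hj => hW j (by omega))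
      (fun j hj => hξ j (by omega)) a) (hi k (by omega)) (hξ k (by omega))

theorem measurable_average {n N : ℕ} {Ω : Type*} [MeasurableSpace Ω]
    {x : Fin n → Ω → EuclideanSpace ℝ (Fin N)} (hx : ∀ j, Measurable (x j)) :
    Measurable fun ω => average fun j => x j ω :=
  (Finset.measurable_sum _ fun j _ => hx j).const_smul (n : ℝ)⁻¹

theorem measurable_mixing_apply {n : ℕ} {Ω : Type*} [MeasurableSpace Ω]
    {W : ℕ → Ω → Matrix (Fin n) (Fin n) ℝ} (t m : ℕ) (hW : ∀ k, t ≤ k → Measurable (W k))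
    (a b : Fin n) : Measurable fun ω => mixing (W · ω) t m a b := by
  induction m generalizing t a b with
  | zero => exact measurable_const
  | succ m ih =>
    simp only [mixing, Matrix.mul_apply]
    exact Finset.measurable_sum _ fun l _ => (measurable_matrix_apply (hW t le_rfl) a l).mul
      (ih (t + 1) (fun k hk => hW k (by omega)) l b)

theorem measurable_colDeviation_mixing {n : ℕ} {Ω : Type*} [MeasurableSpace Ω]
    {W : ℕ → Ω → Matrix (Fin n) (Fin n) ℝ} (t m : ℕ) (hW : ∀ k, t ≤ k → Measurable (W k))
    (j : Fin n) : Measurable fun ω => colDeviation (mixing (W · ω) t m) j :=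
  Finset.measurable_sum _ fun l _ => ((measurable_mixing_apply t m hW l j).sub_const _).pow_const 2

/-! ### Independence of past and sample, and integration over the sample -/

/-- Functions of disjoint blocks of an independent sequence are independent. -/
theorem indepFun_of_disjoint {Ω ι : Type*} {mΩ : MeasurableSpace Ω} {P : Measure Ω}
    {S : ι → Type*} [∀ k, MeasurableSpace (S k)] {Y : ∀ k, Ω → S k} (h : iIndepFun Y P)
    (hY : ∀ k, Measurable (Y k)) {I J : Set ι} (hIJ : Disjoint I J) {α β : Type*}
    [MeasurableSpace α] [MeasurableSpace β] {f : Ω → α} {g : Ω → β}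
    (hf : Measurable[⨆ k ∈ I, MeasurableSpace.comap (Y k) inferInstance] f)
    (hg : Measurable[⨆ k ∈ J, MeasurableSpace.comap (Y k) inferInstance] g) : IndepFun f g P := by
  rw [IndepFun_iff_Indep]
  exact indep_of_indep_of_le_right (indep_of_indep_of_le_left
    (indep_iSup_of_disjoint (fun k => (hY k).comap_le) h.iIndep hIJ) hf.comap_le) hg.comap_le

theorem measurable_of_mem_iSup_comap {Ω ι : Type*} {S : ι → Type*} [∀ k, MeasurableSpace (S k)]
    (Y : ∀ k, Ω → S k) {I : Set ι} {k : ι} (hk : k ∈ I) :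
    Measurable[⨆ k ∈ I, MeasurableSpace.comap (Y k) inferInstance] (Y k) :=
  (comap_measurable (Y k)).mono (le_iSup₂_of_le k hk le_rfl) le_rfl

/-- The joint law, on the event that worker `a` is selected, of a variable `U` determined by the
past and of the batch. -/
theorem map_restrict_prodMk_eq {Ω α ζ 𝒰 : Type*} [MeasurableSpace Ω] [MeasurableSpace α]
    [MeasurableSingletonClass α] [MeasurableSpace ζ] [MeasurableSpace 𝒰] {P : Measure Ω}
    [IsProbabilityMeasure P] {i : Ω → α} {ξ : Ω → ζ} {U : Ω → 𝒰} (hi : Measurable i)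
    (hξ : Measurable ξ) (hU : Measurable U) (hind : IndepFun U (fun ω => (i ω, ξ ω)) P) (a : α)
    {c : ENNReal} {ν : Measure ζ} [SFinite ν]
    (hlaw : ∀ B, MeasurableSet B → P {ω | i ω = a ∧ ξ ω ∈ B} = c * ν B) :
    (P.restrict {ω | i ω = a}).map (fun ω => (U ω, ξ ω)) = c • (P.map U).prod ν := by
  have hia : MeasurableSet {ω | i ω = a} := hi (measurableSet_singleton a)
  -- The product measure is formed with the unnormalized law of `ξ` on the event `i = a`, so workers
  -- of probability zero need no separate treatment.
  have hcν : c • ν = (P.restrict {ω | i ω = a}).map ξ := by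
    ext B hB
    rw [Measure.map_apply hξ hB, Measure.restrict_apply (hξ hB), Measure.smul_apply, smul_eq_mul,
      ← hlaw B hB]
    congr 1
    ext ω
    simp [and_comm]
  have : IsProbabilityMeasure (P.map U) := Measure.isProbabilityMeasure_map hU.aemeasurable
  rw [← Measure.prod_smul_right, hcν]
  symm
  refine Measure.prod_eq fun s t hs ht => ?_
  rw [Measure.map_apply (hU.prodMk hξ) (hs.prod ht),
    Measure.restrict_apply ((hU.prodMk hξ) (hs.prod ht)), Measure.map_apply hU hs,
    Measure.map_apply hξ ht, Measure.restrict_apply (hξ ht)]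
  have h1 := hind.measure_inter_preimage_eq_mul s ({a} ×ˢ t) hs ((measurableSet_singleton a).prod ht)
  have e1 : (fun ω => (U ω, ξ ω)) ⁻¹' s ×ˢ t ∩ {ω | i ω = a} =
      U ⁻¹' s ∩ (fun ω => (i ω, ξ ω)) ⁻¹' ({a} ×ˢ t) := by
    ext ω; simp; tauto
  have e2 : ξ ⁻¹' t ∩ {ω | i ω = a} = (fun ω => (i ω, ξ ω)) ⁻¹' ({a} ×ˢ t) := by
    ext ω; simp; tauto
  rw [e1, e2, h1]

/-- The tower property for nonnegative functions. It assumes no integrability, so it can be used to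
prove that batch gradients are square integrable; the Bochner version below then handles inner
products. -/
theorem lintegral_eq_sum_of_law {Ω α ζ 𝒰 : Type*} [MeasurableSpace Ω] [MeasurableSpace α]
    [Fintype α] [MeasurableSingletonClass α] [MeasurableSpace ζ] [MeasurableSpace 𝒰] {P : Measure Ω}
    [IsProbabilityMeasure P] {i : Ω → α} {ξ : Ω → ζ} {U : Ω → 𝒰} (hi : Measurable i)
    (hξ : Measurable ξ) (hU : Measurable U) (hind : IndepFun U (fun ω => (i ω, ξ ω)) P)
    {c : α → ENNReal} {ν : α → Measure ζ} [∀ a, SFinite (ν a)]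
    (hlaw : ∀ a B, MeasurableSet B → P {ω | i ω = a ∧ ξ ω ∈ B} = c a * ν a B)
    {h : α → 𝒰 × ζ → ENNReal} (hh : ∀ a, Measurable (h a)) :
    ∫⁻ ω, h (i ω) (U ω, ξ ω) ∂P = ∑ a, c a * ∫⁻ ω, ∫⁻ z, h a (U ω, z) ∂(ν a) ∂P := by
  classical
  have hia : ∀ a, MeasurableSet {ω | i ω = a} := fun a => hi (measurableSet_singleton a)
  have h1 : ∀ ω, h (i ω) (U ω, ξ ω) =
      ∑ a, {ω | i ω = a}.indicator (fun ω => h a (U ω, ξ ω)) ω := fun ω => by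
    simp [Set.indicator_apply]
  simp_rw [h1]
  have h2 : ∀ a, Measurable ({ω | i ω = a}.indicator (fun ω => h a (U ω, ξ ω))) := fun a =>
    ((hh a).comp (hU.prodMk hξ)).indicator (hia a)
  rw [lintegral_finsetSum _ fun a _ => h2 a]
  refine Finset.sum_congr rfl fun a _ => ?_
  rw [lintegral_indicator (hia a), ← lintegral_map (hh a) (hU.prodMk hξ),
    map_restrict_prodMk_eq hi hξ hU hind a (hlaw a), lintegral_smul_measure,
    lintegral_prod _ (hh a).aemeasurable, lintegral_map (hh a).lintegral_prod_right' hU, smul_eq_mul]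

theorem integral_eq_sum_of_law {Ω α ζ 𝒰 : Type*} [MeasurableSpace Ω] [MeasurableSpace α]
    [Fintype α] [MeasurableSingletonClass α] [MeasurableSpace ζ] [MeasurableSpace 𝒰] {P : Measure Ω}
    [IsProbabilityMeasure P] {i : Ω → α} {ξ : Ω → ζ} {U : Ω → 𝒰} (hi : Measurable i)
    (hξ : Measurable ξ) (hU : Measurable U) (hind : IndepFun U (fun ω => (i ω, ξ ω)) P)
    {c : α → ℝ} (hc : ∀ a, 0 ≤ c a) {ν : α → Measure ζ} [∀ a, SFinite (ν a)]
    (hlaw : ∀ a B, MeasurableSet B → P {ω | i ω = a ∧ ξ ω ∈ B} = ENNReal.ofReal (c a) * ν a B)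
    {h : α → 𝒰 × ζ → ℝ} (hh : ∀ a, Measurable (h a))
    (hint : Integrable (fun ω => h (i ω) (U ω, ξ ω)) P) :
    ∫ ω, h (i ω) (U ω, ξ ω) ∂P = ∑ a, c a * ∫ ω, ∫ z, h a (U ω, z) ∂(ν a) ∂P := by
  classical
  have hia : ∀ a, MeasurableSet {ω | i ω = a} := fun a => hi (measurableSet_singleton a)
  have h1 : ∀ ω, h (i ω) (U ω, ξ ω) =
      ∑ a, {ω | i ω = a}.indicator (fun ω => h a (U ω, ξ ω)) ω := fun ω => by
    simp [Set.indicator_apply]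
  have h2 : ∀ a, {ω | i ω = a}.indicator (fun ω => h a (U ω, ξ ω)) =
      {ω | i ω = a}.indicator (fun ω => h (i ω) (U ω, ξ ω)) := fun a => by
    refine Set.indicator_congr fun ω hω => ?_
    simp only [Set.mem_ofPred_eq] at hω
    rw [hω]
  have hint' : ∀ a, Integrable ({ω | i ω = a}.indicator (fun ω => h a (U ω, ξ ω))) P := fun a => by
    rw [h2]
    exact hint.indicator (hia a)
  simp_rw [h1]
  rw [integral_finsetSum _ fun a _ => hint' a]
  refine Finset.sum_congr rfl fun a _ => ?_
  have hmap := map_restrict_prodMk_eq hi hξ hU hind a (hlaw a)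
  have h3 : Integrable (h a) (ENNReal.ofReal (c a) • (P.map U).prod (ν a)) := by
    rw [← hmap, integrable_map_measure (hh a).aestronglyMeasurable (hU.prodMk hξ).aemeasurable]
    exact (integrable_indicator_iff (hia a)).1 (hint' a)
  rw [integral_indicator (hia a), ← integral_map (f := h a) (hU.prodMk hξ).aemeasurable
    (hh a).aestronglyMeasurable, hmap, integral_smul_measure, ENNReal.toReal_ofReal (hc a),
    smul_eq_mul]
  -- For a worker of weight zero both sides vanish, although `h a` need not be integrable for the
  -- product law.
  rcases (hc a).eq_or_lt with hca | hca
  · simp [← hca]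
  rw [integrable_smul_measure (by simpa using hca) ENNReal.ofReal_ne_top] at h3
  rw [integral_prod _ h3, integral_map hU.aemeasurable]
  exact ((hh a).stronglyMeasurable.integral_prod_right').aestronglyMeasurable

/-! ### Second moment of a mini-batch -/

theorem integrable_inner_of_memLp_two {Ω E : Type*} [MeasurableSpace Ω] [NormedAddCommGroup E]
    [InnerProductSpace ℝ E] {P : Measure Ω} {f g : Ω → E} (hf : MemLp f 2 P) (hg : MemLp g 2 P) :
    Integrable (fun ω => inner ℝ (f ω) (g ω)) P := by
  refine ((hf.integrable_norm_pow two_ne_zero).add (hg.integrable_norm_pow two_ne_zero)).mono'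
    (hf.1.inner hg.1) (.of_forall fun ω => ?_)
  have := norm_inner_le_norm (𝕜 := ℝ) (f ω) (g ω)
  simp only [Pi.add_apply]
  nlinarith [sq_nonneg (‖f ω‖ - ‖g ω‖), sq_nonneg (‖f ω‖ + ‖g ω‖)]

/-- Second moment of a sum of independent samples. -/
theorem integral_norm_sum_sq_le {E ζ : Type*} [NormedAddCommGroup E] [InnerProductSpace ℝ E]
    [CompleteSpace E] [MeasurableSpace E] [BorelSpace E] [SecondCountableTopology E]
    [MeasurableSpace ζ] {D : Measure ζ} [IsProbabilityMeasure D] {G : ζ → E} {μ : E} {σ : ℝ}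
    (hG : Measurable G) (hint : Integrable G D) (hmean : ∫ z, G z ∂D = μ)
    (hsq : Integrable (fun z => ‖G z - μ‖ ^ 2) D) (hσ : ∫ z, ‖G z - μ‖ ^ 2 ∂D ≤ σ ^ 2) (M : ℕ) :
    Integrable (fun z : Fin M → ζ => ∑ m, G (z m)) (Measure.pi fun _ => D) ∧
    ∫ z : Fin M → ζ, (∑ m, G (z m)) ∂(Measure.pi fun _ => D) = (M : ℝ) • μ ∧
    Integrable (fun z : Fin M → ζ => ‖∑ m, G (z m)‖ ^ 2) (Measure.pi fun _ => D) ∧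
    ∫ z : Fin M → ζ, ‖∑ m, G (z m)‖ ^ 2 ∂(Measure.pi fun _ => D) ≤
      M * σ ^ 2 + M ^ 2 * ‖μ‖ ^ 2 := by
  set Q : Measure (Fin M → ζ) := Measure.pi fun _ => D with hQ
  have hmp : ∀ m, MeasurePreserving (Function.eval m) Q D := fun m => measurePreserving_eval _ m
  set c : ζ → E := fun z => G z - μ with hc
  have hcm : Measurable c := hG.sub_const μ
  have hci : Integrable c D := hint.sub (integrable_const μ)
  have hc0 : ∫ z, c z ∂D = 0 := by
    rw [hc, integral_sub hint (integrable_const μ), hmean]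
    simp
  have hc2 : MemLp c 2 D := (memLp_two_iff_integrable_sq_norm hcm.aestronglyMeasurable).2 hsq
  have hcm2 : ∀ m, MemLp (fun z : Fin M → ζ => c (z m)) 2 Q := fun m =>
    hc2.comp_measurePreserving (hmp m)
  have hcmi : ∀ m, Integrable (fun z : Fin M → ζ => c (z m)) Q := fun m =>
    (hcm2 m).integrable one_le_two
  have hcmz : ∀ m, ∫ z : Fin M → ζ, c (z m) ∂Q = 0 := fun m => by
    rw [← hc0, ← (hmp m).map_eq, integral_map (hmp m).measurable.aemeasurable
      hcm.aestronglyMeasurable]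
  have hS2 : MemLp (fun z : Fin M → ζ => ∑ m, c (z m)) 2 Q :=
    memLp_finsetSum _ fun m _ => hcm2 m
  have hSi := hS2.integrable one_le_two
  have hS0 : ∫ z : Fin M → ζ, ∑ m, c (z m) ∂Q = 0 := by
    rw [integral_finsetSum _ fun m _ => hcmi m]
    simp [hcmz]
  have hsum : ∀ z : Fin M → ζ, ∑ m, G (z m) = (∑ m, c (z m)) + (M : ℝ) • μ := fun z => by
    simp [hc, Finset.sum_sub_distrib, Nat.cast_smul_eq_nsmul]
  have hii : ∀ m m', Integrable (fun z : Fin M → ζ => inner ℝ (c (z m)) (c (z m'))) Q :=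
    fun m m' => integrable_inner_of_memLp_two (hcm2 m) (hcm2 m')
  have hS2n : ∫ z : Fin M → ζ, ‖∑ m, c (z m)‖ ^ 2 ∂Q ≤ M * σ ^ 2 := by
    have e1 : ∀ z : Fin M → ζ, ‖∑ m, c (z m)‖ ^ 2 =
        ∑ m, ∑ m', inner ℝ (c (z m)) (c (z m')) := fun z => by
      rw [← real_inner_self_eq_norm_sq, sum_inner]
      simp_rw [inner_sum]
    simp_rw [e1]
    rw [integral_finsetSum _ fun m _ => integrable_finsetSum _ fun m' _ => hii m m']
    have e2 : ∀ m, ∫ z : Fin M → ζ, ∑ m', inner ℝ (c (z m)) (c (z m')) ∂Q ≤ σ ^ 2 := fun m => by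
      rw [integral_finsetSum _ fun m' _ => hii m m', Finset.sum_eq_single m]
      · simp_rw [real_inner_self_eq_norm_sq]
        rw [← (hmp m).map_eq, integral_map (hmp m).measurable.aemeasurable
          (by fun_prop)] at hσ
        exact hσ
      -- Distinct samples are independent and centred, so the cross terms vanish; only the diagonal
      -- contributes, and the variance grows like `M`, not `M²`.
      · intro m' _ hm'
        have hi := (iIndepFun_pi (μ := fun _ : Fin M => D) (X := fun _ => c)
          fun _ => hcm.aemeasurable).indepFun hm'.symm
        have := hi.integral_bilin (hcmi m) (hcmi m') (innerSL ℝ)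
        exact this.trans (by rw [hcmz m, map_zero, zero_apply])
      · simp
    refine (Finset.sum_le_sum fun m _ => e2 m).trans ?_
    simp
  have hn2 : Integrable (fun z : Fin M → ζ => ‖∑ m, c (z m)‖ ^ 2) Q := hS2.integrable_norm_pow'
  have hin : Integrable (fun z : Fin M → ζ => inner ℝ (∑ m, c (z m)) ((M : ℝ) • μ)) Q :=
    hSi.inner_const _
  have hadd : Integrable (fun z : Fin M → ζ => ‖∑ m, c (z m)‖ ^ 2 +
      2 * inner ℝ (∑ m, c (z m)) ((M : ℝ) • μ)) Q := hn2.add (hin.const_mul 2)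
  have hexp : ∀ z : Fin M → ζ, ‖∑ m, G (z m)‖ ^ 2 = ‖∑ m, c (z m)‖ ^ 2 +
      2 * inner ℝ (∑ m, c (z m)) ((M : ℝ) • μ) + ‖(M : ℝ) • μ‖ ^ 2 := fun z => by
    rw [hsum, norm_add_sq_real]
  refine ⟨?_, ?_, ?_, ?_⟩
  · simp_rw [hsum]
    exact hSi.add (integrable_const _)
  · simp_rw [hsum]
    rw [integral_add hSi (integrable_const _), hS0]
    simp
  · simp_rw [hexp]
    exact hadd.add (integrable_const _)
  · simp_rw [hexp]
    rw [integral_add hadd (integrable_const _),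
      integral_add hn2 (hin.const_mul 2), integral_const_mul]
    have : ∫ z : Fin M → ζ, inner ℝ (∑ m, c (z m)) ((M : ℝ) • μ) ∂Q = 0 := by
      simp_rw [real_inner_comm ((M : ℝ) • μ)]
      rw [integral_inner hSi, hS0, inner_zero_right]
    rw [this]
    simp [norm_smul, mul_pow]
    exact hS2n

/-! ### Contraction by products of random doubly stochastic matrices -/

theorem integrable_apply_of_doublyStochastic {n : ℕ} {Ω : Type*} [MeasurableSpace Ω]
    {P : Measure Ω} [IsFiniteMeasure P] {A : Ω → Matrix (Fin n) (Fin n) ℝ}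
    (hA : ∀ᵐ ω ∂P, A ω ∈ doublyStochastic ℝ (Fin n)) {a b : Fin n}
    (hm : Measurable fun ω => A ω a b) : Integrable (fun ω => A ω a b) P := by
  refine Integrable.of_bound hm.aestronglyMeasurable 1 ?_
  filter_upwards [hA] with ω hω
  rw [Real.norm_of_nonneg (nonneg_of_mem_doublyStochastic hω)]
  exact le_one_of_mem_doublyStochastic hω

theorem transpose_mul_self_mem_doublyStochastic {n : ℕ} {A : Matrix (Fin n) (Fin n) ℝ}
    (hA : A ∈ doublyStochastic ℝ (Fin n)) : Aᵀ * A ∈ doublyStochastic ℝ (Fin n) :=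
  mul_mem (transpose_mem_doublyStochastic_iff.2 hA) hA

theorem measurable_transpose_mul_self_apply {n : ℕ} {Ω : Type*} [MeasurableSpace Ω]
    {W : Ω → Matrix (Fin n) (Fin n) ℝ} (hW : Measurable W) (a b : Fin n) :
    Measurable fun ω => ((W ω)ᵀ * W ω) a b := by
  simp only [Matrix.mul_apply, Matrix.transpose_apply]
  exact Finset.measurable_sum _ fun l _ =>
    (measurable_matrix_apply hW l a).mul (measurable_matrix_apply hW l b)

theorem measurable_mixing_col_sub {n : ℕ} {Ω : Type*} [MeasurableSpace Ω]
    {W : ℕ → Ω → Matrix (Fin n) (Fin n) ℝ} (t m : ℕ) (hW : ∀ k, t ≤ k → Measurable (W k))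
    (j : Fin n) (c : ℝ) : Measurable fun ω l => mixing (W · ω) t m l j - c :=
  measurable_pi_lambda _ fun l => (measurable_mixing_apply t m hW l j).sub_const c

theorem secondMoment_mulVec_one {n : ℕ} {Ω : Type*} [MeasurableSpace Ω] {P : Measure Ω}
    [IsProbabilityMeasure P] {W : Ω → Matrix (Fin n) (Fin n) ℝ} (hW : Measurable W)
    (hds : ∀ᵐ ω ∂P, W ω ∈ doublyStochastic ℝ (Fin n)) : secondMoment P W *ᵥ 1 = 1 := by
  have hds' : ∀ᵐ ω ∂P, (W ω)ᵀ * W ω ∈ doublyStochastic ℝ (Fin n) :=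
    hds.mono fun ω h => transpose_mul_self_mem_doublyStochastic h
  ext a
  simp only [Matrix.mulVec, dotProduct, secondMoment, Matrix.of_apply, Pi.one_apply, mul_one]
  rw [← integral_finsetSum _ fun b _ => integrable_apply_of_doublyStochastic hds'
    (measurable_transpose_mul_self_apply hW a b)]
  rw [integral_congr_ae (g := fun _ => 1) (hds'.mono fun ω h => sum_row_of_mem_doublyStochastic h a)]
  simp

/-- For at least two workers this is the spectral estimate, applicable because `𝔼[WᵀW]` fixes `1`;
for fewer, a vector of sum zero is zero. -/
theorem secondMoment_quadratic_le {n : ℕ} {Ω : Type*} [MeasurableSpace Ω] {P : Measure Ω}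
    [IsProbabilityMeasure P] {W : Ω → Matrix (Fin n) (Fin n) ℝ} (hW : Measurable W)
    (hds : ∀ᵐ ω ∂P, W ω ∈ doublyStochastic ℝ (Fin n)) {ρ : ℝ} (hρ_lt : ρ < 1)
    (hρ : ∀ hn : 2 ≤ n, eig (secondMoment_isHermitian P W) ⟨1, by omega⟩ ≤ ρ)
    {v : Fin n → ℝ} (hv : ∑ j, v j = 0) :
    v ⬝ᵥ secondMoment P W *ᵥ v ≤ ρ * (v ⬝ᵥ v) := by
  rcases Nat.lt_or_ge n 2 with h | h
  · have : v = 0 := by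
      ext j
      have : Subsingleton (Fin n) := Fin.subsingleton_iff_le_one.2 (by omega)
      rw [Fintype.sum_subsingleton _ j] at hv
      exact hv
    simp [this]
  · exact dotProduct_mulVec_le_of_eig h _ (secondMoment_mulVec_one hW hds) hρ_lt (hρ h) hv

theorem colDeviation_one {n : ℕ} (j : Fin n) :
    colDeviation (1 : Matrix (Fin n) (Fin n) ℝ) j = ((n : ℝ) - 1) / n := by
  have hn : (n : ℝ) ≠ 0 := by
    have := j.pos
    positivity
  have h : ∀ l, ((1 : Matrix (Fin n) (Fin n) ℝ) l j - (n : ℝ)⁻¹) ^ 2 =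
      (if l = j then 1 - 2 * (n : ℝ)⁻¹ else 0) + (n : ℝ)⁻¹ ^ 2 := fun l => by
    by_cases hl : l = j
    · subst hl
      simp only [Matrix.one_apply_eq, if_true]
      ring
    · simp [hl]
  simp only [colDeviation, h, Finset.sum_add_distrib, Finset.sum_ite_eq', Finset.mem_univ, if_true,
    Finset.sum_const, Finset.card_univ, Fintype.card_fin, nsmul_eq_mul]
  field_simp
  ring

/-- Rows of `A` sum to one, so `A` fixes the uniform vector: the centred column of `A * B` is `A`
applied to the centred column of `B`. Its squared norm is a quadratic form in `Aᵀ * A`. -/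
theorem colDeviation_mul {n : ℕ} {A B : Matrix (Fin n) (Fin n) ℝ}
    (hA : A ∈ doublyStochastic ℝ (Fin n)) (j : Fin n) :
    colDeviation (A * B) j =
      ∑ a, ∑ b, (Aᵀ * A) a b * ((B a j - (n : ℝ)⁻¹) * (B b j - (n : ℝ)⁻¹)) := by
  have h : ∀ l, (A * B) l j - (n : ℝ)⁻¹ = ∑ a, A l a * (B a j - (n : ℝ)⁻¹) := fun l => by
    simp only [Matrix.mul_apply, mul_sub, Finset.sum_sub_distrib, ← Finset.sum_mul,
      sum_row_of_mem_doublyStochastic hA, one_mul]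
  simp only [colDeviation, h]
  simp_rw [sq, Finset.sum_mul_sum]
  simp only [Matrix.mul_apply, Matrix.transpose_apply, Finset.sum_mul]
  rw [Finset.sum_comm]
  refine Finset.sum_congr rfl fun a _ => ?_
  rw [Finset.sum_comm]
  exact Finset.sum_congr rfl fun b _ => Finset.sum_congr rfl fun l _ => by ring

/-- The expected deviation of the columns of a product of independent doubly stochastic matrices
from the uniform vector decays geometrically. -/
theorem integral_colDeviation_mixing_le {n : ℕ} {Ω : Type*} [MeasurableSpace Ω] {P : Measure Ω}
    [IsProbabilityMeasure P] {W : ℕ → Ω → Matrix (Fin n) (Fin n) ℝ} (hW : ∀ k, Measurable (W k))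
    (hds : ∀ k, ∀ᵐ ω ∂P, W k ω ∈ doublyStochastic ℝ (Fin n)) (hind : iIndepFun W P) {ρ : ℝ}
    (hρ0 : 0 ≤ ρ) (hquad : ∀ k (v : Fin n → ℝ), ∑ j, v j = 0 →
      v ⬝ᵥ secondMoment P (W k) *ᵥ v ≤ ρ * (v ⬝ᵥ v)) (t m : ℕ) (j : Fin n) :
    Integrable (fun ω => colDeviation (mixing (W · ω) t m) j) P ∧
    ∫ ω, colDeviation (mixing (W · ω) t m) j ∂P ≤ ((n : ℝ) - 1) / n * ρ ^ m := by
  have hds_all : ∀ᵐ ω ∂P, ∀ k, W k ω ∈ doublyStochastic ℝ (Fin n) := ae_all_iff.2 hds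
  have hn : 1 ≤ (n : ℝ) := by exact_mod_cast j.pos
  have hVm : ∀ t m l, Measurable fun ω => mixing (W · ω) t m l j - (n : ℝ)⁻¹ := fun t m l =>
    (measurable_mixing_apply t m (fun k _ => hW k) l j).sub_const _
  have hVb : ∀ t m l, ∀ᵐ ω ∂P, ‖mixing (W · ω) t m l j - (n : ℝ)⁻¹‖ ≤ 1 := fun t m l => by
    filter_upwards [hds_all] with ω hω
    have h1 := mixing_mem_doublyStochastic hω t m
    have h2 : (n : ℝ)⁻¹ ≤ 1 := inv_le_one_of_one_le₀ hn
    have h3 : 0 ≤ (n : ℝ)⁻¹ := by positivity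
    rw [Real.norm_eq_abs, abs_le]
    constructor
    · linarith [nonneg_of_mem_doublyStochastic h1 (i := l) (j := j)]
    · linarith [le_one_of_mem_doublyStochastic h1 (i := l) (j := j)]
  have hVV : ∀ t m a b, Integrable (fun ω => (mixing (W · ω) t m a j - (n : ℝ)⁻¹) *
      (mixing (W · ω) t m b j - (n : ℝ)⁻¹)) P := fun t m a b => by
    refine Integrable.of_bound ((hVm t m a).mul (hVm t m b)).aestronglyMeasurable 1 ?_
    filter_upwards [hVb t m a, hVb t m b] with ω h1 h2
    rw [norm_mul]
    exact mul_le_one₀ h1 (norm_nonneg _) h2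
  refine ⟨?_, ?_⟩
  · exact integrable_finsetSum _ fun l _ => by simpa only [sq] using hVV t m l l
  induction m generalizing t with
  | zero => simp [mixing, colDeviation_one]
  | succ m ih =>
    set V : Ω → Fin n → ℝ := fun ω l => mixing (W · ω) (t + 1) m l j - (n : ℝ)⁻¹ with hV
    -- The earliest matrix `W t` is independent of the column built from the later ones. Hence `WᵀW`
    -- may be replaced by its mean inside the quadratic form.
    have hindV : IndepFun (W t) V P := by
      refine indepFun_of_disjoint hind hW (I := {t}) (J := Set.Ici (t + 1)) (by simp)
        (measurable_of_mem_iSup_comap W rfl) ?_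
      exact @measurable_mixing_col_sub n Ω
        (⨆ k ∈ Set.Ici (t + 1), MeasurableSpace.comap (W k) inferInstance) W (t + 1) m
        (fun k hk => measurable_of_mem_iSup_comap W (I := Set.Ici (t + 1)) hk) j _
    have hds' : ∀ᵐ ω ∂P, (W t ω)ᵀ * W t ω ∈ doublyStochastic ℝ (Fin n) :=
      (hds t).mono fun ω h => transpose_mul_self_mem_doublyStochastic h
    have hAi : ∀ a b, Integrable (fun ω => ((W t ω)ᵀ * W t ω) a b) P := fun a b =>
      integrable_apply_of_doublyStochastic hds' (measurable_transpose_mul_self_apply (hW t) a b)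
    have hindab : ∀ a b, IndepFun (fun ω => ((W t ω)ᵀ * W t ω) a b) (fun ω => V ω a * V ω b) P :=
      fun a b => hindV.comp (φ := fun A : Matrix (Fin n) (Fin n) ℝ => (Aᵀ * A) a b)
        (ψ := fun v : Fin n → ℝ => v a * v b)
        (measurable_transpose_mul_self_apply measurable_id a b) (by fun_prop)
    have hVV' : ∀ a b, Integrable (fun ω => V ω a * V ω b) P := hVV (t + 1) m
    have hint : ∀ a b, Integrable (fun ω => ((W t ω)ᵀ * W t ω) a b * (V ω a * V ω b)) P :=
      fun a b => (hindab a b).integrable_mul (hAi a b) (hVV' a b)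
    calc ∫ ω, colDeviation (mixing (W · ω) t (m + 1)) j ∂P
        = ∫ ω, ∑ a, ∑ b, ((W t ω)ᵀ * W t ω) a b * (V ω a * V ω b) ∂P := by
          refine integral_congr_ae ?_
          filter_upwards [hds t] with ω hω
          rw [mixing, colDeviation_mul hω]
      _ = ∑ a, ∑ b, secondMoment P (W t) a b * ∫ ω, V ω a * V ω b ∂P := by
          rw [integral_finsetSum _ fun a _ => integrable_finsetSum _ fun b _ => hint a b]
          refine Finset.sum_congr rfl fun a _ => ?_
          rw [integral_finsetSum _ fun b _ => hint a b]
          exact Finset.sum_congr rfl fun b _ => (hindab a b).integral_fun_mul_eq_mul_integral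
            (hAi a b).1 (hVV' a b).1
      _ = ∫ ω, V ω ⬝ᵥ secondMoment P (W t) *ᵥ V ω ∂P := by
          simp only [dotProduct, Matrix.mulVec, Finset.mul_sum]
          rw [integral_finsetSum _ fun a _ => integrable_finsetSum _ fun b _ =>
            ((hVV' a b).const_mul (secondMoment P (W t) a b)).congr (.of_forall fun ω => by ring)]
          refine Finset.sum_congr rfl fun a _ => ?_
          rw [integral_finsetSum _ fun b _ =>
            ((hVV' a b).const_mul (secondMoment P (W t) a b)).congr (.of_forall fun ω => by ring)]
          refine Finset.sum_congr rfl fun b _ => ?_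
          rw [← integral_const_mul]
          exact integral_congr_ae (.of_forall fun ω => by ring)
      _ ≤ ∫ ω, ρ * colDeviation (mixing (W · ω) (t + 1) m) j ∂P := by
          refine integral_mono_ae ?_ ?_ ?_
          · simp only [dotProduct, Matrix.mulVec, Finset.mul_sum]
            exact integrable_finsetSum _ fun a _ => integrable_finsetSum _ fun b _ =>
              ((hVV' a b).const_mul (secondMoment P (W t) a b)).congr (.of_forall fun ω => by ring)
          · exact (integrable_finsetSum _ fun l _ => by
              simpa only [sq] using hVV (t + 1) m l l).const_mul ρ
          -- The centred column has sum zero because the columns of the product sum to one; this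
          -- puts it in the range of the spectral gap.
          · filter_upwards [hds_all] with ω hω
            refine (hquad t (V ω) ?_).trans_eq ?_
            · simp only [hV, Finset.sum_sub_distrib, Finset.sum_const, Finset.card_univ,
                Fintype.card_fin, nsmul_eq_mul, sum_col_of_mem_doublyStochastic
                  (mixing_mem_doublyStochastic hω (t + 1) m) j]
              rw [mul_inv_cancel₀ (by linarith), sub_self]
            · simp [hV, colDeviation, dotProduct, sq]
      _ ≤ ((n : ℝ) - 1) / n * ρ ^ (m + 1) := by
          rw [integral_const_mul, pow_succ', mul_left_comm]
          exact mul_le_mul_of_nonneg_left (ih (t + 1)) hρ0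

/-! ### Deterministic inequalities for weighted gradients -/

theorem norm_add_sq_le_two_mul {E : Type*} [SeminormedAddCommGroup E] (u v : E) : ‖u + v‖ ^ 2 ≤ 2 * ‖u‖ ^ 2 + 2 * ‖v‖ ^ 2 := by
  have := norm_add_le u v
  nlinarith [norm_nonneg (u + v), sq_nonneg (‖u‖ - ‖v‖)]

theorem norm_sum_sq_le_card_mul {E : Type*} [SeminormedAddCommGroup E] (s : Finset ℕ) (g : ℕ → E) :
    ‖∑ t ∈ s, g t‖ ^ 2 ≤ s.card * ∑ t ∈ s, ‖g t‖ ^ 2 :=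
  (pow_le_pow_left₀ (norm_nonneg _) (norm_sum_le _ _) 2).trans sq_sum_le_card_mul_sum_sq

theorem norm_gradient_sub_sq_le {α E : Type*} [NormedAddCommGroup E] [InnerProductSpace ℝ E]
    [CompleteSpace E] {f : α → E → ℝ} {L : ℝ≥0} (hL : ∀ a, LipschitzWith L (gradient (f a))) (a : α)
    (x y : E) :
    ‖gradient (f a) x - gradient (f a) y‖ ^ 2 ≤ L ^ 2 * ‖x - y‖ ^ 2 := by
  rw [← mul_pow]
  exact pow_le_pow_left₀ (norm_nonneg _) ((hL a).norm_sub_le x y) 2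

section Deterministic

variable {α E : Type*} [Fintype α] [NormedAddCommGroup E] [InnerProductSpace ℝ E]

theorem sum_mul_norm_sub_sq {p : α → ℝ} (hp : ∑ a, p a = 1) (v : α → E) (c : E) :
    ∑ a, p a * ‖v a - c‖ ^ 2 =
      ∑ a, p a * ‖v a‖ ^ 2 - 2 * inner ℝ (∑ a, p a • v a) c + ‖c‖ ^ 2 := by
  simp_rw [norm_sub_sq_real, mul_add, mul_sub, Finset.sum_add_distrib, Finset.sum_sub_distrib,
    ← Finset.sum_mul, hp, one_mul, sum_inner, real_inner_smul_left, Finset.mul_sum]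
  congr 2
  exact Finset.sum_congr rfl fun a _ => by ring

theorem norm_sum_smul_sq_le {p : α → ℝ} (hp0 : ∀ a, 0 ≤ p a) (hp : ∑ a, p a = 1) (v : α → E) :
    ‖∑ a, p a • v a‖ ^ 2 ≤ ∑ a, p a * ‖v a‖ ^ 2 := by
  have h1 := sum_mul_norm_sub_sq hp v (∑ a, p a • v a)
  rw [real_inner_self_eq_norm_sq] at h1
  have h2 : 0 ≤ ∑ a, p a * ‖v a - ∑ a, p a • v a‖ ^ 2 :=
    Finset.sum_nonneg fun a _ => mul_nonneg (hp0 a) (sq_nonneg _)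
  linarith

/-- Second moment equals squared mean plus variance, and the variance is at most the spread about
any point `c`. This keeps coefficient one on the squared mean. -/
theorem sum_mul_norm_sq_le {p : α → ℝ} (hp : ∑ a, p a = 1) (v : α → E) (c : E) :
    ∑ a, p a * ‖v a‖ ^ 2 ≤ ‖∑ a, p a • v a‖ ^ 2 + ∑ a, p a * ‖v a - c‖ ^ 2 := by
  rw [sum_mul_norm_sub_sq hp]
  have := norm_sub_sq_real (∑ a, p a • v a) c
  nlinarith [sq_nonneg ‖(∑ a, p a • v a) - c‖]

variable [CompleteSpace E] {p : α → ℝ} {f : α → E → ℝ} {L : ℝ≥0}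

theorem hasGradientAt_weightedSum (hf : ∀ a, Differentiable ℝ (f a)) (x : E) :
    HasGradientAt (fun y => ∑ a, p a * f a y) (∑ a, p a • gradient (f a) x) x := by
  rw [hasGradientAt_iff_hasFDerivAt, map_sum]
  refine HasFDerivAt.fun_sum fun a _ => ?_
  have := ((hf a x).hasGradientAt.hasFDerivAt).const_mul (p a)
  refine this.congr_fderiv ?_
  ext y
  simp

theorem lipschitzWith_gradient_weightedSum (hp0 : ∀ a, 0 ≤ p a) (hp : ∑ a, p a = 1)
    (hf : ∀ a, Differentiable ℝ (f a)) (hL : ∀ a, LipschitzWith L (gradient (f a))) :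
    LipschitzWith L (gradient fun y => ∑ a, p a * f a y) := by
  refine LipschitzWith.of_dist_le_mul fun x y => ?_
  rw [dist_eq_norm, dist_eq_norm, (hasGradientAt_weightedSum hf x).gradient,
    (hasGradientAt_weightedSum hf y).gradient, ← Finset.sum_sub_distrib]
  calc ‖∑ a, (p a • gradient (f a) x - p a • gradient (f a) y)‖
      ≤ ∑ a, p a * (L * ‖x - y‖) := by
        refine norm_sum_le_of_le _ fun a _ => ?_
        rw [← smul_sub, norm_smul, Real.norm_of_nonneg (hp0 a)]
        exact mul_le_mul_of_nonneg_left ((hL a).norm_sub_le x y) (hp0 a)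
    _ = L * ‖x - y‖ := by rw [← Finset.sum_mul, hp, one_mul]

/-- The second moment of the worker gradients at different points. -/
theorem sum_mul_norm_gradient_sq_le (hp0 : ∀ a, 0 ≤ p a) (hp : ∑ a, p a = 1)
    (hL : ∀ a, LipschitzWith L (gradient (f a))) {ς : ℝ}
    {c : E} (y : α → E) (z : E) (hς : ∑ a, p a * ‖gradient (f a) z - c‖ ^ 2 ≤ ς ^ 2) :
    ∑ a, p a * ‖gradient (f a) (y a)‖ ^ 2 ≤ ‖∑ a, p a • gradient (f a) (y a)‖ ^ 2 +
      2 * L ^ 2 * ∑ a, p a * ‖y a - z‖ ^ 2 + 2 * ς ^ 2 := by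
  have h1 := sum_mul_norm_sq_le hp (fun a => gradient (f a) (y a)) c
  have h2 : ∑ a, p a * ‖gradient (f a) (y a) - c‖ ^ 2 ≤
      ∑ a, (2 * L ^ 2 * (p a * ‖y a - z‖ ^ 2) + 2 * (p a * ‖gradient (f a) z - c‖ ^ 2)) := by
    refine Finset.sum_le_sum fun a _ => ?_
    have e1 := norm_add_sq_le_two_mul (gradient (f a) (y a) - gradient (f a) z)
      (gradient (f a) z - c)
    rw [sub_add_sub_cancel] at e1
    have e2 := norm_gradient_sub_sq_le hL a (y a) z
    nlinarith [mul_le_mul_of_nonneg_left (e1.trans (by linarith : _ ≤ 2 * (L ^ 2 * ‖y a - z‖ ^ 2) +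
      2 * ‖gradient (f a) z - c‖ ^ 2)) (hp0 a)]
  rw [Finset.sum_add_distrib, ← Finset.mul_sum, ← Finset.mul_sum] at h2
  linarith

/-- The intermediate point `z` will be the delayed average: the first term then measures staleness
and the second the consensus error. -/
theorem norm_gradient_sub_sum_sq_le (hp0 : ∀ a, 0 ≤ p a) (hp : ∑ a, p a = 1)
    (hf : ∀ a, Differentiable ℝ (f a)) (hL : ∀ a, LipschitzWith L (gradient (f a)))
    (y : α → E) (x z : E) :
    ‖gradient (fun y => ∑ a, p a * f a y) x - ∑ a, p a • gradient (f a) (y a)‖ ^ 2 ≤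
      2 * L ^ 2 * ‖x - z‖ ^ 2 + 2 * L ^ 2 * ∑ a, p a * ‖y a - z‖ ^ 2 := by
  set φ := fun y => ∑ a, p a * f a y
  have e1 := norm_add_sq_le_two_mul (gradient φ x - gradient φ z)
    (gradient φ z - ∑ a, p a • gradient (f a) (y a))
  rw [sub_add_sub_cancel] at e1
  have e2 : ‖gradient φ x - gradient φ z‖ ^ 2 ≤ L ^ 2 * ‖x - z‖ ^ 2 := by
    rw [← mul_pow]
    exact pow_le_pow_left₀ (norm_nonneg _)
      ((lipschitzWith_gradient_weightedSum hp0 hp hf hL).norm_sub_le x z) 2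
  have e3 : ‖gradient φ z - ∑ a, p a • gradient (f a) (y a)‖ ^ 2 ≤
      L ^ 2 * ∑ a, p a * ‖y a - z‖ ^ 2 := by
    rw [(hasGradientAt_weightedSum hf z).gradient, ← Finset.sum_sub_distrib]
    simp_rw [← smul_sub]
    refine (norm_sum_smul_sq_le hp0 hp _).trans ?_
    rw [Finset.mul_sum]
    refine Finset.sum_le_sum fun a _ => ?_
    rw [mul_left_comm]
    refine mul_le_mul_of_nonneg_left ?_ (hp0 a)
    rw [norm_sub_rev (y a)]
    exact norm_gradient_sub_sq_le hL a z (y a)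
  linarith

end Deterministic

/-! ### The abstract random process and its square integrability -/

theorem memLp_comp_of_lipschitz {Ω E E' : Type*} [MeasurableSpace Ω] {P : Measure Ω}
    [IsFiniteMeasure P] [NormedAddCommGroup E] [NormedAddCommGroup E'] {G : E → E'} {L : ℝ≥0}
    (hG : LipschitzWith L G) {x : Ω → E} (hx : MemLp x 2 P) : MemLp (fun ω => G (x ω)) 2 P := by
  have h1 : MemLp (fun ω => G (x ω) - G 0) 2 P := by
    refine hx.of_le_mul (c := L) ((hG.continuous.comp_aestronglyMeasurable hx.1).sub
      aestronglyMeasurable_const) (.of_forall fun ω => ?_)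
    simpa using hG.norm_sub_le (x ω) 0
  exact (h1.add (memLp_const (G 0))).ae_eq (.of_forall fun ω => by simp)

/-- The random processes of AD-PSGD: local models `x` and batch gradients `g`, for local losses `f`,
stochastic gradients `G`, and samples `i`, `W`, `ξ`. -/
structure IsRun {n N M : ℕ} {Z Ω : Type*} [MeasurableSpace Z] [MeasurableSpace Ω]
    (f : Fin n → EuclideanSpace ℝ (Fin N) → ℝ)
    (G : Fin n → EuclideanSpace ℝ (Fin N) → Z → EuclideanSpace ℝ (Fin N))
    (D : Fin n → Measure Z) (p : Fin n → ℝ) (L : ℝ≥0) (σ γ : ℝ) (τ : ℕ → ℕ)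
    (x₀ : EuclideanSpace ℝ (Fin N)) (P : Measure Ω) (i : ℕ → Ω → Fin n)
    (W : ℕ → Ω → Matrix (Fin n) (Fin n) ℝ) (ξ : ℕ → Ω → Fin M → Z)
    (x : ℕ → Fin n → Ω → EuclideanSpace ℝ (Fin N)) (g : ℕ → Ω → EuclideanSpace ℝ (Fin N)) :
    Prop where
  p_nonneg : ∀ a, 0 ≤ p a
  p_sum : ∑ a, p a = 1
  lipschitz : ∀ a, LipschitzWith L (gradient (f a))
  G_meas : ∀ a, Measurable fun q : EuclideanSpace ℝ (Fin N) × Z => G a q.1 q.2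
  G_int : ∀ a y, Integrable (G a y) (D a)
  G_mean : ∀ a y, ∫ z, G a y z ∂(D a) = gradient (f a) y
  var_int : ∀ a y, Integrable (fun z => ‖G a y z - gradient (f a) y‖ ^ 2) (D a)
  var_le : ∀ a y, ∫ z, ‖G a y z - gradient (f a) y‖ ^ 2 ∂(D a) ≤ σ ^ 2
  i_meas : ∀ k, Measurable (i k)
  W_meas : ∀ k, Measurable (W k)
  ξ_meas : ∀ k, Measurable (ξ k)
  indep : iIndepFun (fun k ω => (i k ω, W k ω, ξ k ω)) P
  batch_law : ∀ k a (B : Set (Fin M → Z)), MeasurableSet B →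
    P {ω | i k ω = a ∧ ξ k ω ∈ B} = ENNReal.ofReal (p a) * Measure.pi (fun _ => D a) B
  W_ds : ∀ k, ∀ᵐ ω ∂P, W k ω ∈ doublyStochastic ℝ (Fin n)
  x_zero : ∀ j ω, x 0 j ω = x₀
  x_succ : ∀ k j ω, x (k + 1) j ω =
    (∑ l, W k ω l j • x k l ω) - if j = i k ω then γ • g k ω else 0
  g_eq : ∀ k ω, g k ω = ∑ m, G (i k ω) (x (k - τ k) (i k ω) ω) (ξ k ω m)
  -- The local models at time `k` depend on the samples of steps before `k`; the gradient `g k` also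
  -- depends on that of step `k`. All independence arguments rest on this pair of fields.
  x_past : ∀ k j, Measurable[⨆ t ∈ Set.Iio k, MeasurableSpace.comap
    (fun ω => (i t ω, W t ω, ξ t ω)) inferInstance] (x k j)
  g_past : ∀ k, Measurable[⨆ t ∈ Set.Iio (k + 1), MeasurableSpace.comap
    (fun ω => (i t ω, W t ω, ξ t ω)) inferInstance] (g k)

namespace IsRun

variable {n N M : ℕ} {Z Ω : Type*} [MeasurableSpace Z] [MeasurableSpace Ω]
  {f : Fin n → EuclideanSpace ℝ (Fin N) → ℝ}
  {G : Fin n → EuclideanSpace ℝ (Fin N) → Z → EuclideanSpace ℝ (Fin N)}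
  {D : Fin n → Measure Z} {p : Fin n → ℝ} {L : ℝ≥0} {σ γ : ℝ} {τ : ℕ → ℕ}
  {x₀ : EuclideanSpace ℝ (Fin N)} {P : Measure Ω} {i : ℕ → Ω → Fin n}
  {W : ℕ → Ω → Matrix (Fin n) (Fin n) ℝ} {ξ : ℕ → Ω → Fin M → Z}
  {x : ℕ → Fin n → Ω → EuclideanSpace ℝ (Fin N)} {g : ℕ → Ω → EuclideanSpace ℝ (Fin N)}

theorem sample_meas (h : IsRun f G D p L σ γ τ x₀ P i W ξ x g) (k : ℕ) :
    Measurable fun ω => (i k ω, W k ω, ξ k ω) :=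
  (h.i_meas k).prodMk ((h.W_meas k).prodMk (h.ξ_meas k))

theorem past_le (h : IsRun f G D p L σ γ τ x₀ P i W ξ x g) (I : Set ℕ) :
    (⨆ t ∈ I, MeasurableSpace.comap (fun ω => (i t ω, W t ω, ξ t ω)) inferInstance) ≤
      ‹MeasurableSpace Ω› :=
  iSup₂_le fun t _ => (h.sample_meas t).comap_le

theorem x_meas (h : IsRun f G D p L σ γ τ x₀ P i W ξ x g) (k : ℕ) (j : Fin n) :
    Measurable (x k j) := (h.x_past k j).mono (h.past_le _) le_rfl

theorem g_meas (h : IsRun f G D p L σ γ τ x₀ P i W ξ x g) (k : ℕ) :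
    Measurable (g k) := (h.g_past k).mono (h.past_le _) le_rfl

theorem n_pos (h : IsRun f G D p L σ γ τ x₀ P i W ξ x g) : 0 < n := by
  rcases Nat.eq_zero_or_pos n with rfl | hn
  · simpa using h.p_sum
  · exact hn

theorem ae_ds (h : IsRun f G D p L σ γ τ x₀ P i W ξ x g) :
    ∀ᵐ ω ∂P, ∀ k, W k ω ∈ doublyStochastic ℝ (Fin n) := ae_all_iff.2 h.W_ds

theorem average_meas (h : IsRun f G D p L σ γ τ x₀ P i W ξ x g) (k : ℕ) :
    Measurable fun ω => average fun j => x k j ω := measurable_average (h.x_meas k)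

/-- The local models at steps up to `k` are independent of the samples drawn at step `k`. -/
theorem indepFun_past_sample (h : IsRun f G D p L σ γ τ x₀ P i W ξ x g) (k : ℕ) :
    IndepFun (fun ω => (average fun j => x k j ω, fun j => x (k - τ k) j ω))
      (fun ω => (i k ω, ξ k ω)) P := by
  have h1 : IndepFun (fun ω => (average fun j => x k j ω, fun j => x (k - τ k) j ω))
      (fun ω => (i k ω, W k ω, ξ k ω)) P := by
    refine indepFun_of_disjoint h.indep h.sample_meas (I := Set.Iio k) (J := {k}) (by simp) ?_
      (measurable_of_mem_iSup_comap (fun t ω => (i t ω, W t ω, ξ t ω)) rfl)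
    refine @Measurable.prodMk _ _ _ _ _ (_) _ _ (@measurable_average _ _ _ (_) _ (h.x_past k)) ?_
    refine @measurable_pi_lambda _ _ _ (_) _ _ fun j => ?_
    exact (h.x_past (k - τ k) j).mono
      (biSup_mono fun t ht => lt_of_lt_of_le ht (Nat.sub_le _ _)) le_rfl
  exact h1.comp (φ := id) (ψ := fun q => (q.1, q.2.2)) measurable_id (by fun_prop)

theorem batch_meas (h : IsRun f G D p L σ γ τ x₀ P i W ξ x g) (a : Fin n) :
    Measurable fun q : (EuclideanSpace ℝ (Fin N) × (Fin n → EuclideanSpace ℝ (Fin N))) ×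
      (Fin M → Z) => ∑ m, G a (q.1.2 a) (q.2 m) := by
  refine Finset.measurable_sum _ fun m _ => ?_
  have hm : Measurable fun q : (EuclideanSpace ℝ (Fin N) × (Fin n → EuclideanSpace ℝ (Fin N))) ×
      (Fin M → Z) => (q.1.2 a, q.2 m) :=
    ((measurable_pi_apply a).comp (measurable_snd.comp measurable_fst)).prodMk
      ((measurable_pi_apply m).comp measurable_snd)
  exact (h.G_meas a).comp hm

theorem memLp_gradient [IsProbabilityMeasure P]
    (h : IsRun f G D p L σ γ τ x₀ P i W ξ x g) {k : ℕ} {a : Fin n}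
    (hx : MemLp (x k a) 2 P) : MemLp (fun ω => gradient (f a) (x k a ω)) 2 P :=
  memLp_comp_of_lipschitz (h.lipschitz a) hx

variable [∀ a, IsProbabilityMeasure (D a)]

theorem batch_moments (h : IsRun f G D p L σ γ τ x₀ P i W ξ x g) (a : Fin n)
    (y : EuclideanSpace ℝ (Fin N)) :
    Integrable (fun z : Fin M → Z => ∑ m, G a y (z m)) (Measure.pi fun _ => D a) ∧
    ∫ z : Fin M → Z, (∑ m, G a y (z m)) ∂(Measure.pi fun _ => D a) =
      (M : ℝ) • gradient (f a) y ∧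
    Integrable (fun z : Fin M → Z => ‖∑ m, G a y (z m)‖ ^ 2) (Measure.pi fun _ => D a) ∧
    ∫ z : Fin M → Z, ‖∑ m, G a y (z m)‖ ^ 2 ∂(Measure.pi fun _ => D a) ≤
      M * σ ^ 2 + M ^ 2 * ‖gradient (f a) y‖ ^ 2 :=
  integral_norm_sum_sq_le ((h.G_meas a).comp measurable_prodMk_left)
    (h.G_int a y) (h.G_mean a y) (h.var_int a y) (h.var_le a y) M

variable [IsProbabilityMeasure P]

/-- The current sample is integrated out with the delayed models frozen. -/
theorem lintegral_norm_g_sq_le (h : IsRun f G D p L σ γ τ x₀ P i W ξ x g) (k : ℕ) :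
    ∫⁻ ω, ENNReal.ofReal (‖g k ω‖ ^ 2) ∂P ≤ ∑ a, ENNReal.ofReal (p a) *
      ∫⁻ ω, ENNReal.ofReal (M * σ ^ 2 + M ^ 2 * ‖gradient (f a) (x (k - τ k) a ω)‖ ^ 2) ∂P := by
  have hU : Measurable fun ω => (average fun j => x k j ω, fun j => x (k - τ k) j ω) :=
    (h.average_meas k).prodMk (measurable_pi_lambda _ fun j => h.x_meas _ j)
  have h1 := lintegral_eq_sum_of_law (h.i_meas k) (h.ξ_meas k) hU (h.indepFun_past_sample k)
    (h.batch_law k) (h := fun a q => ENNReal.ofReal (‖∑ m, G a (q.1.2 a) (q.2 m)‖ ^ 2))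
    fun a => ENNReal.measurable_ofReal.comp ((h.batch_meas a).norm.pow_const 2)
  simp_rw [h.g_eq]
  rw [h1]
  refine Finset.sum_le_sum fun a _ => mul_le_mul_right (lintegral_mono fun ω => ?_) _
  obtain ⟨-, -, h2, h3⟩ := h.batch_moments a (x (k - τ k) a ω)
  dsimp only
  rw [← ofReal_integral_eq_lintegral_ofReal h2 (.of_forall fun _ => sq_nonneg _)]
  exact ENNReal.ofReal_le_ofReal h3

/-- Square integrability is assumed only for the models at step `k - τ k`, so that the lemma can
serve inside the induction showing it for all models. -/
theorem integral_norm_g_sq_aux (h : IsRun f G D p L σ γ τ x₀ P i W ξ x g) {k : ℕ}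
    (hx : ∀ a, MemLp (x (k - τ k) a) 2 P) :
    MemLp (g k) 2 P ∧ ∫ ω, ‖g k ω‖ ^ 2 ∂P ≤ M * σ ^ 2 + M ^ 2 * ∑ a, p a *
      ∫ ω, ‖gradient (f a) (x (k - τ k) a ω)‖ ^ 2 ∂P := by
  have hi : ∀ a, Integrable (fun ω => ‖gradient (f a) (x (k - τ k) a ω)‖ ^ 2) P := fun a =>
    (h.memLp_gradient (hx a)).integrable_norm_pow two_ne_zero
  have hi2 : ∀ a, Integrable (fun ω => M * σ ^ 2 +
      M ^ 2 * ‖gradient (f a) (x (k - τ k) a ω)‖ ^ 2) P := fun a =>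
    (integrable_const _).add ((hi a).const_mul _)
  have hint : ∀ a, ∫ ω, (M * σ ^ 2 + M ^ 2 * ‖gradient (f a) (x (k - τ k) a ω)‖ ^ 2) ∂P =
      M * σ ^ 2 + M ^ 2 * ∫ ω, ‖gradient (f a) (x (k - τ k) a ω)‖ ^ 2 ∂P := fun a => by
    rw [integral_add (integrable_const _) ((hi a).const_mul _), integral_const_mul ((M : ℝ) ^ 2)]
    simp
  have hnn : ∀ a, 0 ≤ p a * ∫ ω, (M * σ ^ 2 +
      M ^ 2 * ‖gradient (f a) (x (k - τ k) a ω)‖ ^ 2) ∂P := fun a =>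
    mul_nonneg (h.p_nonneg a) (integral_nonneg fun ω => by positivity)
  have h1 : ∫⁻ ω, ENNReal.ofReal (‖g k ω‖ ^ 2) ∂P ≤ ENNReal.ofReal (M * σ ^ 2 + M ^ 2 *
      ∑ a, p a * ∫ ω, ‖gradient (f a) (x (k - τ k) a ω)‖ ^ 2 ∂P) := by
    refine (h.lintegral_norm_g_sq_le k).trans_eq ?_
    have e : ∀ a, ENNReal.ofReal (p a) * ∫⁻ ω, ENNReal.ofReal (M * σ ^ 2 +
        M ^ 2 * ‖gradient (f a) (x (k - τ k) a ω)‖ ^ 2) ∂P = ENNReal.ofReal (p a *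
        ∫ ω, (M * σ ^ 2 + M ^ 2 * ‖gradient (f a) (x (k - τ k) a ω)‖ ^ 2) ∂P) := fun a => by
      rw [← ofReal_integral_eq_lintegral_ofReal (hi2 a) (.of_forall fun _ => by positivity),
        ENNReal.ofReal_mul (h.p_nonneg a)]
    simp_rw [e]
    rw [← ENNReal.ofReal_sum_of_nonneg fun a _ => hnn a]
    congr 1
    simp_rw [hint, mul_add, Finset.sum_add_distrib, ← Finset.sum_mul, h.p_sum, one_mul,
      Finset.mul_sum, mul_left_comm]
  have h2 : Integrable (fun ω => ‖g k ω‖ ^ 2) P := by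
    refine ⟨((h.g_meas k).norm.pow_const 2).aestronglyMeasurable, ?_⟩
    rw [hasFiniteIntegral_iff_ofReal (.of_forall fun _ => sq_nonneg _)]
    exact h1.trans_lt ENNReal.ofReal_lt_top
  refine ⟨(memLp_two_iff_integrable_sq_norm (h.g_meas k).aestronglyMeasurable).2 h2, ?_⟩
  rw [← ofReal_integral_eq_lintegral_ofReal h2 (.of_forall fun _ => sq_nonneg _)] at h1
  refine (ENNReal.ofReal_le_ofReal_iff ?_).1 h1
  have : 0 ≤ ∑ a, p a * ∫ ω, ‖gradient (f a) (x (k - τ k) a ω)‖ ^ 2 ∂P :=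
    Finset.sum_nonneg fun a _ =>
      mul_nonneg (h.p_nonneg a) (integral_nonneg fun ω => by positivity)
  positivity

/-- Strong induction, since `g k` reads the models at the earlier index `k - τ k`. Averaging
preserves `L²` because the matrix entries lie in `[0, 1]`. -/
theorem memLp_x (h : IsRun f G D p L σ γ τ x₀ P i W ξ x g) (k : ℕ) (j : Fin n) :
    MemLp (x k j) 2 P := by
  induction k using Nat.strong_induction_on generalizing j with
  | _ k ih =>
    cases k with
    | zero =>
      rw [show x 0 j = fun _ => x₀ from funext (h.x_zero j)]
      exact memLp_const _
    | succ k =>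
      have h1 : MemLp (fun ω => ∑ l, W k ω l j • x k l ω) 2 P := memLp_finsetSum _ fun l _ => by
        refine (ih k (by omega) l).of_le
          ((measurable_matrix_apply (h.W_meas k) l j).smul (h.x_meas k l)).aestronglyMeasurable ?_
        filter_upwards [h.W_ds k] with ω hω
        rw [norm_smul, Real.norm_of_nonneg (nonneg_of_mem_doublyStochastic hω)]
        exact mul_le_of_le_one_left (norm_nonneg _) (le_one_of_mem_doublyStochastic hω)
      have h2 : MemLp (fun ω => if j = i k ω then γ • g k ω else 0) 2 P := by
        have hg := (h.integral_norm_g_sq_aux (k := k) fun a => ih _ (by omega) a).1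
        refine (hg.const_smul γ).of_le ?_ (.of_forall fun ω => ?_)
        · refine (Measurable.ite ?_ ((h.g_meas k).const_smul γ) measurable_const).aestronglyMeasurable
          have : {ω | j = i k ω} = i k ⁻¹' {j} := by ext; simp [eq_comm]
          rw [this]
          exact h.i_meas k (measurableSet_singleton j)
        · split_ifs <;> simp
      exact (h1.sub h2).ae_eq (.of_forall fun ω => (h.x_succ k j ω).symm)

theorem memLp_g (h : IsRun f G D p L σ γ τ x₀ P i W ξ x g) (k : ℕ) : MemLp (g k) 2 P :=
  (h.integral_norm_g_sq_aux fun a => h.memLp_x _ a).1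

theorem memLp_average (h : IsRun f G D p L σ γ τ x₀ P i W ξ x g) (k : ℕ) :
    MemLp (fun ω => average fun j => x k j ω) 2 P :=
  (memLp_finsetSum _ fun j _ => h.memLp_x k j).const_smul (n : ℝ)⁻¹

theorem memLp_meanGrad (h : IsRun f G D p L σ γ τ x₀ P i W ξ x g) (k : ℕ) :
    MemLp (fun ω => ∑ a, p a • gradient (f a) (x k a ω)) 2 P :=
  memLp_finsetSum _ fun a _ => (h.memLp_gradient (h.memLp_x k a)).const_smul (p a)

end IsRun

/-! ### Expected one-step estimates -/

namespace IsRun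

variable {n N M : ℕ} {Z Ω : Type*} [MeasurableSpace Z] [MeasurableSpace Ω]
  {f : Fin n → EuclideanSpace ℝ (Fin N) → ℝ}
  {G : Fin n → EuclideanSpace ℝ (Fin N) → Z → EuclideanSpace ℝ (Fin N)}
  {D : Fin n → Measure Z} {p : Fin n → ℝ} {L : ℝ≥0} {σ γ : ℝ} {τ : ℕ → ℕ}
  {x₀ : EuclideanSpace ℝ (Fin N)} {P : Measure Ω} {i : ℕ → Ω → Fin n}
  {W : ℕ → Ω → Matrix (Fin n) (Fin n) ℝ} {ξ : ℕ → Ω → Fin M → Z}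
  {x : ℕ → Fin n → Ω → EuclideanSpace ℝ (Fin N)} {g : ℕ → Ω → EuclideanSpace ℝ (Fin N)}

theorem average_succ_ae (h : IsRun f G D p L σ γ τ x₀ P i W ξ x g) :
    ∀ᵐ ω ∂P, ∀ k, (average fun j => x (k + 1) j ω) =
      (average fun j => x k j ω) - (γ / n) • g k ω := by
  filter_upwards [h.ae_ds] with ω hω k
  exact average_succ h.n_pos.ne' hω (x := fun k j => x k j ω) (g := fun k => g k ω)
    (fun j => h.x_zero j ω) (fun k j => h.x_succ k j ω) k

variable [∀ a, IsProbabilityMeasure (D a)] [IsProbabilityMeasure P]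

/-- The batch gradient is in expectation `M` times the mean worker gradient, also when tested
against a function of the average model. -/
theorem integral_inner_g (h : IsRun f G D p L σ γ τ x₀ P i W ξ x g)
    {Φ : EuclideanSpace ℝ (Fin N) → EuclideanSpace ℝ (Fin N)} (hΦ : LipschitzWith L Φ) (k : ℕ) :
    ∫ ω, inner ℝ (Φ (average fun j => x k j ω)) (g k ω) ∂P =
      M * ∫ ω, inner ℝ (Φ (average fun j => x k j ω))
        (∑ a, p a • gradient (f a) (x (k - τ k) a ω)) ∂P := by
  have hU : Measurable fun ω => (average fun j => x k j ω, fun j => x (k - τ k) j ω) :=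
    (h.average_meas k).prodMk (measurable_pi_lambda _ fun j => h.x_meas _ j)
  have hΦx : MemLp (fun ω => Φ (average fun j => x k j ω)) 2 P :=
    memLp_comp_of_lipschitz hΦ (h.memLp_average k)
  have hint := integrable_inner_of_memLp_two hΦx (h.memLp_g k)
  simp_rw [h.g_eq] at hint ⊢
  have h1 := integral_eq_sum_of_law (h.i_meas k) (h.ξ_meas k) hU (h.indepFun_past_sample k)
    h.p_nonneg (h.batch_law k) (h := fun a q => inner ℝ (Φ q.1.1) (∑ m, G a (q.1.2 a) (q.2 m)))
    (fun a => (hΦ.continuous.measurable.comp (measurable_fst.comp measurable_fst)).inner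
      (h.batch_meas a)) hint
  have h2 : ∀ a ω, ∫ z : Fin M → Z, inner ℝ (Φ (average fun j => x k j ω))
      (∑ m, G a (x (k - τ k) a ω) (z m)) ∂(Measure.pi fun _ => D a) =
      M * inner ℝ (Φ (average fun j => x k j ω)) (gradient (f a) (x (k - τ k) a ω)) :=
    fun a ω => by
      obtain ⟨h3, h4, -, -⟩ := h.batch_moments a (x (k - τ k) a ω)
      rw [integral_inner h3, h4, real_inner_smul_right]
  refine h1.trans ?_
  simp only [h2, integral_const_mul]
  simp only [inner_sum (𝕜 := ℝ) Finset.univ (fun a => p a • gradient (f a) (x (k - τ k) a _)),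
    real_inner_smul_right]
  rw [integral_finsetSum _ fun a _ => (integrable_inner_of_memLp_two hΦx
    (h.memLp_gradient (h.memLp_x _ a))).const_mul _, Finset.mul_sum]
  simp only [integral_const_mul, mul_left_comm]

theorem integrable_norm_g_sq (h : IsRun f G D p L σ γ τ x₀ P i W ξ x g) (k : ℕ) :
    Integrable (fun ω => ‖g k ω‖ ^ 2) P := (h.memLp_g k).integrable_norm_pow two_ne_zero

/-- Expected consensus error of the local models. -/
theorem integral_norm_sub_average_sq_le (h : IsRun f G D p L σ γ τ x₀ P i W ξ x g) {ρ r : ℝ}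
    (hρ0 : 0 ≤ ρ) (hquad : ∀ k (v : Fin n → ℝ), ∑ j, v j = 0 →
      v ⬝ᵥ secondMoment P (W k) *ᵥ v ≤ ρ * (v ⬝ᵥ v)) (hr : 0 < r) (hr1 : r < 1) (hρr : ρ ≤ r ^ 2)
    (k : ℕ) (j : Fin n) :
    ∫ ω, ‖x k j ω - average fun j => x k j ω‖ ^ 2 ∂P ≤
      γ ^ 2 * (((n : ℝ) - 1) / n * ((1 - r)⁻¹ *
        ∑ t ∈ Finset.range k, r ^ (k - 1 - t) * ∫ ω, ‖g t ω‖ ^ 2 ∂P)) := by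
  set w := (1 - r)⁻¹ with hw
  have hw0 : 0 < w := inv_pos.2 (by linarith)
  have hn : 1 ≤ (n : ℝ) := by exact_mod_cast h.n_pos
  have hκ : 0 ≤ ((n : ℝ) - 1) / n := div_nonneg (by linarith) (by linarith)
  have hindW : iIndepFun W P := h.indep.comp (g := fun _ q => q.2.1) fun _ => by fun_prop
  have hdev : ∀ t m, Integrable (fun ω => colDeviation (mixing (W · ω) t m) j) P ∧
      ∫ ω, colDeviation (mixing (W · ω) t m) j ∂P ≤ ((n : ℝ) - 1) / n * ρ ^ m := fun t m =>
    integral_colDeviation_mixing_le h.W_meas h.W_ds hindW hρ0 hquad t m j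
  -- The gradient `g t` uses samples up to step `t`, the mixing product only matrices from step `t +
  -- 1` on.
  have hind : ∀ t m, IndepFun (fun ω => ‖g t ω‖ ^ 2)
      (fun ω => colDeviation (mixing (W · ω) (t + 1) m) j) P := fun t m => by
    have hfut : Measurable[⨆ s ∈ Set.Ici (t + 1), MeasurableSpace.comap
        (fun ω => (i s ω, W s ω, ξ s ω)) inferInstance]
        (fun ω => colDeviation (mixing (W · ω) (t + 1) m) j) := by
      refine @measurable_colDeviation_mixing n Ω (_) W (t + 1) m (fun s hs => ?_) j
      exact (measurable_fst.comp measurable_snd).comp (measurable_of_mem_iSup_comap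
        (fun s ω => (i s ω, W s ω, ξ s ω)) (I := Set.Ici (t + 1)) hs)
    have := indepFun_of_disjoint h.indep h.sample_meas (I := Set.Iio (t + 1))
      (J := Set.Ici (t + 1)) (by simp) (h.g_past t) hfut
    exact this.comp (φ := fun y => ‖y‖ ^ 2) (ψ := id) (by fun_prop) measurable_id
  have hprod : ∀ t m, Integrable (fun ω => ‖g t ω‖ ^ 2 *
      colDeviation (mixing (W · ω) (t + 1) m) j) P := fun t m =>
    (hind t m).integrable_mul (h.integrable_norm_g_sq t) (hdev (t + 1) m).1
  have hpt : ∀ᵐ ω ∂P, ‖x k j ω - average fun j => x k j ω‖ ^ 2 ≤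
      γ ^ 2 * (w * ∑ t ∈ Finset.range k, (r ^ (k - 1 - t))⁻¹ *
        (‖g t ω‖ ^ 2 * colDeviation (mixing (W · ω) (t + 1) (k - 1 - t)) j)) := by
    filter_upwards [h.ae_ds] with ω hω
    exact norm_sub_average_sq_le h.n_pos.ne' hω (x := fun k j => x k j ω) (g := fun k => g k ω)
      (fun j => h.x_zero j ω) (fun k j => h.x_succ k j ω) hr hr1 k j
  have hsum : Integrable (fun ω => γ ^ 2 * (w * ∑ t ∈ Finset.range k, (r ^ (k - 1 - t))⁻¹ *
      (‖g t ω‖ ^ 2 * colDeviation (mixing (W · ω) (t + 1) (k - 1 - t)) j))) P :=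
    ((integrable_finsetSum _ fun t _ => (hprod t _).const_mul _).const_mul _).const_mul _
  refine (integral_mono_ae (((h.memLp_x k j).sub (h.memLp_average k)).integrable_norm_pow
    two_ne_zero) hsum hpt).trans ?_
  rw [integral_const_mul, integral_const_mul, integral_finsetSum _ fun t _ =>
    (hprod t _).const_mul _, mul_left_comm (((n : ℝ) - 1) / n)]
  refine mul_le_mul_of_nonneg_left (mul_le_mul_of_nonneg_left ?_ hw0.le) (sq_nonneg _)
  rw [Finset.mul_sum]
  refine Finset.sum_le_sum fun t _ => ?_
  rw [integral_const_mul, (hind t _).integral_fun_mul_eq_mul_integral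
    (h.integrable_norm_g_sq t).1 (hdev (t + 1) _).1.1]
  set m := k - 1 - t
  have ha : 0 ≤ ∫ ω, ‖g t ω‖ ^ 2 ∂P := integral_nonneg fun ω => sq_nonneg _
  have hrm : 0 < r ^ m := pow_pos hr m
  -- The decay `ρ^m ≤ r^m * r^m` pays for the inverse weight from Cauchy–Schwarz and still leaves
  -- one factor `r^m`.
  calc (r ^ m)⁻¹ * ((∫ ω, ‖g t ω‖ ^ 2 ∂P) *
        ∫ ω, colDeviation (mixing (W · ω) (t + 1) m) j ∂P)
      ≤ (r ^ m)⁻¹ * ((∫ ω, ‖g t ω‖ ^ 2 ∂P) * (((n : ℝ) - 1) / n * (r ^ m * r ^ m))) := by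
        gcongr
        refine (hdev (t + 1) m).2.trans ?_
        gcongr
        rw [← mul_pow, ← sq]
        exact pow_le_pow_left₀ hρ0 hρr m
    _ = _ := by field_simp

/-- Expected squared norm of a batch gradient. -/
theorem integral_norm_g_sq_le (h : IsRun f G D p L σ γ τ x₀ P i W ξ x g) {ς : ℝ}
    (hς : ∀ z, ∑ a, p a * ‖gradient (f a) z - gradient (fun y => ∑ a, p a * f a y) z‖ ^ 2 ≤ ς ^ 2)
    (k : ℕ) :
    ∫ ω, ‖g k ω‖ ^ 2 ∂P ≤ M * σ ^ 2 + 2 * M ^ 2 * ς ^ 2 +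
      M ^ 2 * (∫ ω, ‖∑ a, p a • gradient (f a) (x (k - τ k) a ω)‖ ^ 2 ∂P) +
      2 * M ^ 2 * L ^ 2 * ∑ a, p a *
        ∫ ω, ‖x (k - τ k) a ω - average fun j => x (k - τ k) j ω‖ ^ 2 ∂P := by
  have h1 := (h.integral_norm_g_sq_aux fun a => h.memLp_x (k - τ k) a).2
  have i1 : ∀ a, Integrable (fun ω => p a * ‖gradient (f a) (x (k - τ k) a ω)‖ ^ 2) P := fun a =>
    ((h.memLp_gradient (h.memLp_x _ a)).integrable_norm_pow two_ne_zero).const_mul _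
  have i2 : Integrable (fun ω => ‖∑ a, p a • gradient (f a) (x (k - τ k) a ω)‖ ^ 2) P :=
    (h.memLp_meanGrad (k - τ k)).integrable_norm_pow two_ne_zero
  have i3 : ∀ a, Integrable (fun ω => p a *
      ‖x (k - τ k) a ω - average fun j => x (k - τ k) j ω‖ ^ 2) P := fun a =>
    (((h.memLp_x _ a).sub (h.memLp_average _)).integrable_norm_pow two_ne_zero).const_mul _
  have i4 : Integrable (fun ω => 2 * (L : ℝ) ^ 2 * ∑ a, p a *
      ‖x (k - τ k) a ω - average fun j => x (k - τ k) j ω‖ ^ 2) P :=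
    (integrable_finsetSum _ fun a _ => i3 a).const_mul _
  have i5 : Integrable (fun ω => ‖∑ a, p a • gradient (f a) (x (k - τ k) a ω)‖ ^ 2 +
      2 * (L : ℝ) ^ 2 * ∑ a, p a *
        ‖x (k - τ k) a ω - average fun j => x (k - τ k) j ω‖ ^ 2) P := i2.add i4
  have h2 := integral_mono (integrable_finsetSum Finset.univ fun a _ => i1 a)
    (i5.add (integrable_const (2 * ς ^ 2)))
    fun ω => sum_mul_norm_gradient_sq_le h.p_nonneg h.p_sum h.lipschitz
      (fun a => x (k - τ k) a ω) (average fun j => x (k - τ k) j ω) (hς _)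
  simp only [Pi.add_apply] at h2
  rw [integral_finsetSum _ fun a _ => i1 a, integral_add i5 (integrable_const _),
    integral_add i2 i4, integral_const_mul (2 * (L : ℝ) ^ 2),
    integral_finsetSum _ fun a _ => i3 a] at h2
  simp only [integral_const_mul, integral_const, probReal_univ, one_smul] at h2
  have h3 := mul_le_mul_of_nonneg_left h2 (sq_nonneg (M : ℝ))
  linarith

/-- Expected error of the mean worker gradient. -/
theorem integral_norm_gradient_sub_sq_le (h : IsRun f G D p L σ γ τ x₀ P i W ξ x g)
    (hf : ∀ a, Differentiable ℝ (f a)) {T : ℕ} (hτ : ∀ k, τ k ≤ T) (k : ℕ) :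
    ∫ ω, ‖gradient (fun y => ∑ a, p a * f a y) (average fun j => x k j ω) -
      ∑ a, p a • gradient (f a) (x (k - τ k) a ω)‖ ^ 2 ∂P ≤
      2 * L ^ 2 * (γ ^ 2 / n ^ 2) *
        (T * ∑ t ∈ Finset.Ico (k - τ k) k, ∫ ω, ‖g t ω‖ ^ 2 ∂P) +
      2 * L ^ 2 * ∑ a, p a *
        ∫ ω, ‖x (k - τ k) a ω - average fun j => x (k - τ k) j ω‖ ^ 2 ∂P := by
  have hφ := lipschitzWith_gradient_weightedSum h.p_nonneg h.p_sum hf h.lipschitz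
  have i1 : Integrable (fun ω => ‖gradient (fun y => ∑ a, p a * f a y)
      (average fun j => x k j ω) - ∑ a, p a • gradient (f a) (x (k - τ k) a ω)‖ ^ 2) P :=
    ((memLp_comp_of_lipschitz hφ (h.memLp_average k)).sub
      (h.memLp_meanGrad _)).integrable_norm_pow two_ne_zero
  have i3 : ∀ a, Integrable (fun ω => p a *
      ‖x (k - τ k) a ω - average fun j => x (k - τ k) j ω‖ ^ 2) P := fun a =>
    (((h.memLp_x _ a).sub (h.memLp_average _)).integrable_norm_pow two_ne_zero).const_mul _
  have i4 : Integrable (fun ω => 2 * (L : ℝ) ^ 2 * ∑ a, p a *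
      ‖x (k - τ k) a ω - average fun j => x (k - τ k) j ω‖ ^ 2) P :=
    (integrable_finsetSum _ fun a _ => i3 a).const_mul _
  have i6 : Integrable (fun ω => 2 * (L : ℝ) ^ 2 * (γ ^ 2 / n ^ 2) *
      (T * ∑ t ∈ Finset.Ico (k - τ k) k, ‖g t ω‖ ^ 2)) P :=
    ((integrable_finsetSum _ fun t _ => h.integrable_norm_g_sq t).const_mul _).const_mul _
  have h2 : ∀ᵐ ω ∂P, ‖gradient (fun y => ∑ a, p a * f a y) (average fun j => x k j ω) -
      ∑ a, p a • gradient (f a) (x (k - τ k) a ω)‖ ^ 2 ≤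
      2 * (L : ℝ) ^ 2 * (γ ^ 2 / n ^ 2) * (T * ∑ t ∈ Finset.Ico (k - τ k) k, ‖g t ω‖ ^ 2) +
      2 * (L : ℝ) ^ 2 * ∑ a, p a *
        ‖x (k - τ k) a ω - average fun j => x (k - τ k) j ω‖ ^ 2 := by
    filter_upwards [h.average_succ_ae] with ω hω
    refine (norm_gradient_sub_sum_sq_le h.p_nonneg h.p_sum hf h.lipschitz
      (fun a => x (k - τ k) a ω) _ (average fun j => x (k - τ k) j ω)).trans ?_
    refine add_le_add_left ?_ _
    -- Between steps `k - τ k` and `k` the average moves by at most `T` multiples of batch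
    -- gradients; Cauchy–Schwarz over this window produces the factor `T`.
    have e1 : (average fun j => x k j ω) - (average fun j => x (k - τ k) j ω) =
        -((γ / n) • ∑ t ∈ Finset.Ico (k - τ k) k, g t ω) := by
      rw [← Finset.sum_Ico_sub (fun k => average fun j => x k j ω) (Nat.sub_le k (τ k)),
        Finset.smul_sum, ← Finset.sum_neg_distrib]
      exact Finset.sum_congr rfl fun t _ => by rw [hω t]; abel
    rw [e1, norm_neg, norm_smul, mul_pow, Real.norm_eq_abs, sq_abs, div_pow, mul_assoc (2 * _)]
    gcongr
    refine (norm_sum_sq_le_card_mul _ fun t => g t ω).trans ?_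
    have : 0 ≤ ∑ t ∈ Finset.Ico (k - τ k) k, ‖g t ω‖ ^ 2 :=
      Finset.sum_nonneg fun _ _ => sq_nonneg _
    refine mul_le_mul_of_nonneg_right ?_ this
    rw [Nat.card_Ico]
    exact_mod_cast (by have := hτ k; omega : k - (k - τ k) ≤ T)
  have h3 := integral_mono_ae i1 (i6.add i4) h2
  simp only [Pi.add_apply] at h3
  rw [integral_add i6 i4, integral_const_mul (2 * (L : ℝ) ^ 2 * (γ ^ 2 / n ^ 2)),
    integral_const_mul (T : ℝ), integral_finsetSum _ fun t _ => h.integrable_norm_g_sq t,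
    integral_const_mul (2 * (L : ℝ) ^ 2), integral_finsetSum _ fun a _ => i3 a] at h3
  simpa only [integral_const_mul] using h3

/-- The objective is bounded below by `b` and above by the quadratic of the descent lemma at `0`,
and the average model is in `L²`. -/
theorem integrable_objective (h : IsRun f G D p L σ γ τ x₀ P i W ξ x g)
    (hf : ∀ a, Differentiable ℝ (f a)) {b : ℝ} (hb : ∀ y, b ≤ ∑ a, p a * f a y) (k : ℕ) :
    Integrable (fun ω => ∑ a, p a * f a (average fun j => x k j ω)) P := by
  set φ : EuclideanSpace ℝ (Fin N) → ℝ := fun y => ∑ a, p a * f a y with hφdef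
  have hφd : Differentiable ℝ φ := fun y => (hasGradientAt_weightedSum hf y).differentiableAt
  have hφ := lipschitzWith_gradient_weightedSum h.p_nonneg h.p_sum hf h.lipschitz
  have hX := h.memLp_average k
  have hdom : Integrable (fun ω => |b| + (|φ 0| + ‖gradient φ 0‖ * ‖average fun j => x k j ω‖ +
      L / 2 * ‖average fun j => x k j ω‖ ^ 2)) P :=
    (integrable_const _).add (((integrable_const _).add
      ((hX.integrable one_le_two).norm.const_mul _)).add
      ((hX.integrable_norm_pow two_ne_zero).const_mul _))
  refine hdom.mono' (hφd.continuous.measurable.comp (h.average_meas k)).aestronglyMeasurable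
    (.of_forall fun ω => ?_)
  have h1 := descent_lemma hφd hφ 0 (average fun j => x k j ω)
  rw [sub_zero] at h1
  have h2 := real_inner_le_norm (gradient φ 0) (average fun j => x k j ω)
  have h3 := hb (average fun j => x k j ω)
  have h4 : 0 ≤ ‖gradient φ 0‖ * ‖average fun j => x k j ω‖ := by positivity
  have h5 : 0 ≤ (L : ℝ) / 2 * ‖average fun j => x k j ω‖ ^ 2 := by positivity
  change |φ (average fun j => x k j ω)| ≤ _
  change b ≤ φ _ at h3
  rw [abs_le]
  constructor
  · linarith [neg_abs_le b, abs_nonneg (φ 0)]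
  · linarith [le_abs_self (φ 0), abs_nonneg b]

/-- Expected decrease of the objective in one step. -/
theorem integral_objective_succ_le (h : IsRun f G D p L σ γ τ x₀ P i W ξ x g)
    (hf : ∀ a, Differentiable ℝ (f a)) {b : ℝ} (hb : ∀ y, b ≤ ∑ a, p a * f a y) (k : ℕ) :
    ∫ ω, (∑ a, p a * f a (average fun j => x (k + 1) j ω)) ∂P ≤
      ∫ ω, (∑ a, p a * f a (average fun j => x k j ω)) ∂P - γ * M / (2 * n) *
      (∫ ω, ‖gradient (fun y => ∑ a, p a * f a y) (average fun j => x k j ω)‖ ^ 2 ∂P +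
        ∫ ω, ‖∑ a, p a • gradient (f a) (x (k - τ k) a ω)‖ ^ 2 ∂P) +
      γ * M / (2 * n) *
        (∫ ω, ‖gradient (fun y => ∑ a, p a * f a y) (average fun j => x k j ω) -
          ∑ a, p a • gradient (f a) (x (k - τ k) a ω)‖ ^ 2 ∂P) +
      γ ^ 2 * L / (2 * n ^ 2) * ∫ ω, ‖g k ω‖ ^ 2 ∂P := by
  set φ : EuclideanSpace ℝ (Fin N) → ℝ := fun y => ∑ a, p a * f a y with hφdef
  have hφd : Differentiable ℝ φ := fun y => (hasGradientAt_weightedSum hf y).differentiableAt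
  have hφ : LipschitzWith L (gradient φ) :=
    lipschitzWith_gradient_weightedSum h.p_nonneg h.p_sum hf h.lipschitz
  have m1 : MemLp (fun ω => gradient φ (average fun j => x k j ω)) 2 P :=
    memLp_comp_of_lipschitz hφ (h.memLp_average k)
  have m2 := h.memLp_meanGrad (k - τ k)
  have i0 : ∀ k, Integrable (fun ω => φ (average fun j => x k j ω)) P :=
    h.integrable_objective hf hb
  have i1 : Integrable (fun ω => γ / n * inner ℝ (gradient φ (average fun j => x k j ω)) (g k ω)) P :=
    (integrable_inner_of_memLp_two m1 (h.memLp_g k)).const_mul _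
  have i2 : Integrable (fun ω => γ ^ 2 * L / (2 * n ^ 2) * ‖g k ω‖ ^ 2) P :=
    (h.integrable_norm_g_sq k).const_mul _
  have i3 : Integrable (fun ω => φ (average fun j => x k j ω) -
      γ / n * inner ℝ (gradient φ (average fun j => x k j ω)) (g k ω)) P := (i0 k).sub i1
  have h1 : ∀ᵐ ω ∂P, φ (average fun j => x (k + 1) j ω) ≤ φ (average fun j => x k j ω) -
      γ / n * inner ℝ (gradient φ (average fun j => x k j ω)) (g k ω) +
      γ ^ 2 * L / (2 * n ^ 2) * ‖g k ω‖ ^ 2 := by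
    filter_upwards [h.average_succ_ae] with ω hω
    refine (descent_lemma hφd hφ (average fun j => x k j ω) _).trans_eq ?_
    rw [hω k, sub_sub_cancel_left, inner_neg_right, real_inner_smul_right, norm_neg, norm_smul,
      mul_pow, Real.norm_eq_abs, sq_abs]
    ring
  have h2 := integral_mono_ae (i0 (k + 1)) (i3.add i2) h1
  simp only [Pi.add_apply] at h2
  rw [integral_add i3 i2, integral_sub (i0 k) i1, integral_const_mul (γ / n),
    integral_const_mul (γ ^ 2 * L / (2 * n ^ 2)), h.integral_inner_g hφ k] at h2
  -- Polarization turns the inner product from the descent lemma into the two squared norms minus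
  -- the squared error.
  have h3 : ∫ ω, ‖gradient φ (average fun j => x k j ω) -
      ∑ a, p a • gradient (f a) (x (k - τ k) a ω)‖ ^ 2 ∂P =
      ∫ ω, ‖gradient φ (average fun j => x k j ω)‖ ^ 2 ∂P -
      2 * (∫ ω, inner ℝ (gradient φ (average fun j => x k j ω))
        (∑ a, p a • gradient (f a) (x (k - τ k) a ω)) ∂P) +
      ∫ ω, ‖∑ a, p a • gradient (f a) (x (k - τ k) a ω)‖ ^ 2 ∂P := by
    have j1 := m1.integrable_norm_pow two_ne_zero
    have j2 := (integrable_inner_of_memLp_two m1 m2).const_mul 2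
    simp_rw [norm_sub_sq_real]
    have j3 : Integrable (fun ω => ‖gradient φ (average fun j => x k j ω)‖ ^ 2 -
      2 * inner ℝ (gradient φ (average fun j => x k j ω))
        (∑ a, p a • gradient (f a) (x (k - τ k) a ω))) P := j1.sub j2
    rw [integral_add j3 (m2.integrable_norm_pow two_ne_zero), integral_sub j1 j2,
      integral_const_mul]
  rw [h3]
  refine h2.trans_eq ?_
  have hn : (n : ℝ) ≠ 0 := by
    have := h.n_pos
    positivity
  field_simp
  ring

end IsRun

/-! ### AD-PSGD as an instance, and the final rate -/

theorem isRun_iterate {n N M : ℕ} {Z : Type*} [MeasurableSpace Z] {D : Fin n → Measure Z}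
    {F : Fin n → EuclideanSpace ℝ (Fin N) → Z → ℝ} {p : Fin n → ℝ}
    (hp_nonneg : ∀ a, 0 ≤ p a) (hp_sum : ∑ a, p a = 1)
    (hF_meas : ∀ a, Measurable fun q : EuclideanSpace ℝ (Fin N) × Z => sampleGrad (F a) q.1 q.2)
    {L : ℝ≥0} (hf_lip : ∀ a, LipschitzWith L (gradient (localLoss (F a) (D a))))
    (hg_int : ∀ a x, Integrable (fun z => sampleGrad (F a) x z) (D a))
    (hg_mean : ∀ a x, ∫ z, sampleGrad (F a) x z ∂(D a) = gradient (localLoss (F a) (D a)) x)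
    {σ : ℝ}
    (hσ_int : ∀ a x, Integrable (fun z => ‖sampleGrad (F a) x z -
      gradient (localLoss (F a) (D a)) x‖ ^ 2) (D a))
    (hσ : ∀ a x, ∫ z, ‖sampleGrad (F a) x z -
      gradient (localLoss (F a) (D a)) x‖ ^ 2 ∂(D a) ≤ σ ^ 2)
    {Ω : Type*} [MeasurableSpace Ω] {P : Measure Ω}
    {i : ℕ → Ω → Fin n} {W : ℕ → Ω → Matrix (Fin n) (Fin n) ℝ} {ξ : ℕ → Ω → Fin M → Z}
    (hi_meas : ∀ k, Measurable (i k)) (hW_meas : ∀ k, Measurable (W k))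
    (hξ_meas : ∀ k, Measurable (ξ k)) (h_indep : iIndepFun (fun k ω => (i k ω, W k ω, ξ k ω)) P)
    (hi_law : ∀ k a, P {ω | i k ω = a} = ENNReal.ofReal (p a))
    (hξ_law : ∀ k a (A : Set (Matrix (Fin n) (Fin n) ℝ)) (B : Set (Fin M → Z)),
      MeasurableSet A → MeasurableSet B →
      P {ω | i k ω = a ∧ W k ω ∈ A ∧ ξ k ω ∈ B} =
        P {ω | i k ω = a ∧ W k ω ∈ A} * Measure.pi (fun _ : Fin M => D a) B)
    (hW_ds : ∀ k, ∀ᵐ ω ∂P, W k ω ∈ doublyStochastic ℝ (Fin n))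
    (τ : ℕ → ℕ) (x₀ : EuclideanSpace ℝ (Fin N)) (γ : ℝ) :
    IsRun (fun a => localLoss (F a) (D a)) (fun a => sampleGrad (F a)) D p L σ γ τ x₀ P i W ξ
      (fun k j ω => iterate F x₀ γ τ (i · ω) (W · ω) (ξ · ω) k j)
      (fun k ω => batchGrad F x₀ γ τ (i · ω) (W · ω) (ξ · ω) k) where
  p_nonneg := hp_nonneg
  p_sum := hp_sum
  lipschitz := hf_lip
  G_meas := hF_meas
  G_int := hg_int
  G_mean := hg_mean
  var_int := hσ_int
  var_le := hσ
  i_meas := hi_meas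
  W_meas := hW_meas
  ξ_meas := hξ_meas
  indep := h_indep
  batch_law k a B hB := by
    have := hξ_law k a Set.univ B MeasurableSet.univ hB
    simpa [hi_law] using this
  W_ds := hW_ds
  x_zero j ω := iterate_zero ..
  x_succ k j ω := iterate_succ ..
  g_eq k ω := rfl
  x_past k j := by
    have hY : ∀ t < k, _ := fun t ht =>
      measurable_of_mem_iSup_comap (fun t ω => (i t ω, W t ω, ξ t ω)) (I := Set.Iio k) ht
    exact @measurable_iterate n N M Z Ω _ (_) F hF_meas x₀ γ τ i W ξ k
      (fun t ht => measurable_fst.comp (hY t ht))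
      (fun t ht => (measurable_fst.comp measurable_snd).comp (hY t ht))
      (fun t ht => (measurable_snd.comp measurable_snd).comp (hY t ht)) j
  g_past k := by
    have hY : ∀ t < k + 1, _ := fun t ht =>
      measurable_of_mem_iSup_comap (fun t ω => (i t ω, W t ω, ξ t ω)) (I := Set.Iio (k + 1)) ht
    exact @measurable_batchGrad n N M Z Ω _ (_) F hF_meas x₀ γ τ i W ξ k
      (fun t ht => measurable_fst.comp (hY t ht))
      (fun t ht => (measurable_fst.comp measurable_snd).comp (hY t ht))
      (fun t ht => (measurable_snd.comp measurable_snd).comp (hY t ht))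

/-- With the prescribed step size, the general bound becomes the rate in `K`. -/
theorem rate_of_stepSize {n M K : ℕ} (hn : 0 < n) (hM : 0 < M) (hK : 0 < K) {L σ ς γ Δ S : ℝ}
    (hL : 0 ≤ L) (hσς : 0 < σ ^ 2 + 6 * M * ς ^ 2)
    (hγ : γ = n / (10 * M * L + √(σ ^ 2 + 6 * M * ς ^ 2) * √(K * M)))
    (hγ' : γ * (√(σ ^ 2 + 6 * M * ς ^ 2) * √(K * M)) ≤ n)
    (hS : S ≤ 2 * n * Δ / (γ * M) + 2 * γ * L / n * (σ ^ 2 + 6 * M * ς ^ 2) * K) :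
    S / K ≤ 20 * Δ * L / K + 2 * (Δ + L) * √(σ ^ 2 / M + 6 * ς ^ 2) / √K := by
  have hn' : (0 : ℝ) < n := by exact_mod_cast hn
  have hM' : (0 : ℝ) < M := by exact_mod_cast hM
  have hK' : (0 : ℝ) < K := by exact_mod_cast hK
  have e1 : √(σ ^ 2 / M + 6 * ς ^ 2) = √(σ ^ 2 + 6 * M * ς ^ 2) / √M := by
    rw [← Real.sqrt_div hσς.le]
    congr 1
    field_simp
  rw [e1]
  set V := σ ^ 2 + 6 * M * ς ^ 2 with hV
  rw [Real.sqrt_mul hK'.le] at hγ hγ'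
  have hV2 : √V ^ 2 = V := Real.sq_sqrt hσς.le
  have hK2 : √(K : ℝ) ^ 2 = K := Real.sq_sqrt hK'.le
  have hM2 : √(M : ℝ) ^ 2 = M := Real.sq_sqrt hM'.le
  have hsV : 0 < √V := Real.sqrt_pos.2 hσς
  have hsK : 0 < √(K : ℝ) := Real.sqrt_pos.2 hK'
  have hsM : 0 < √(M : ℝ) := Real.sqrt_pos.2 hM'
  set v := √V
  set κ := √(K : ℝ)
  set m := √(M : ℝ)
  have hden : 0 < 10 * M * L + v * (κ * m) := by positivity
  -- Inserting `1/γ` splits this term exactly along the two summands of the denominator of `γ`.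
  have e2 : 2 * n * Δ / (γ * M) / K = 20 * Δ * L / K + 2 * Δ * (v / m) / κ := by
    rw [hγ, ← hK2, ← hM2]
    rw [← hM2] at hden
    field_simp
    ring
  have e3 : 2 * γ * L / n * V * K / K ≤ 2 * L * (v / m) / κ := by
    have e4 : 2 * γ * L / n * V * K / K = 2 * L * (v / m) / κ * (γ * (v * (κ * m)) / n) := by
      rw [← hV2]
      field_simp
    rw [e4]
    exact mul_le_of_le_one_right (by positivity) ((div_le_one hn').2 hγ')
  calc S / K ≤ (2 * n * Δ / (γ * M) + 2 * γ * L / n * V * K) / K := by gcongr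
    _ ≤ 20 * Δ * L / K + 2 * Δ * (v / m) / κ + 2 * L * (v / m) / κ := by
      rw [add_div, e2]
      gcongr
    _ = _ := by ring

end ADPSGD

theorem corollary1
    {n N M T K : ℕ} (hM : 0 < M) (hK : 0 < K)
    -- the local data distributions, loss functions and update frequencies
    {Z : Type*} [MeasurableSpace Z]
    (D : Fin n → Measure Z) [∀ a, IsProbabilityMeasure (D a)]
    (F : Fin n → EuclideanSpace ℝ (Fin N) → Z → ℝ)
    (p : Fin n → ℝ) (hp_nonneg : ∀ a, 0 ≤ p a) (hp_sum : ∑ a, p a = 1)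
    (hF_diff : ∀ a z, Differentiable ℝ fun x => F a x z)
    (hF_int : ∀ a x, Integrable (F a x) (D a))
    (hF_meas : ∀ a, Measurable fun q : EuclideanSpace ℝ (Fin N) × Z =>
      ADPSGD.sampleGrad (F a) q.1 q.2)
    -- Lipschitzian gradients
    (L : ℝ≥0) (hf_diff : ∀ a, Differentiable ℝ (ADPSGD.localLoss (F a) (D a)))
    (hf_lip : ∀ a, LipschitzWith L (gradient (ADPSGD.localLoss (F a) (D a))))
    -- the objective is bounded below
    (hf_bdd : BddBelow (Set.range (ADPSGD.objective F D p)))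
    -- unbiased estimation
    (hg_int : ∀ a x, Integrable (fun z => ADPSGD.sampleGrad (F a) x z) (D a))
    (hg_mean : ∀ a x, ∫ z, ADPSGD.sampleGrad (F a) x z ∂(D a) =
      gradient (ADPSGD.localLoss (F a) (D a)) x)
    -- bounded variance
    (σ ς : ℝ)
    (hσ_int : ∀ a x, Integrable (fun z => ‖ADPSGD.sampleGrad (F a) x z -
      gradient (ADPSGD.localLoss (F a) (D a)) x‖ ^ 2) (D a))
    (hσ : ∀ a x, ∫ z, ‖ADPSGD.sampleGrad (F a) x z -
      gradient (ADPSGD.localLoss (F a) (D a)) x‖ ^ 2 ∂(D a) ≤ σ ^ 2)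
    (hς : ∀ x, ∑ a, p a * ‖gradient (ADPSGD.localLoss (F a) (D a)) x -
      gradient (ADPSGD.objective F D p) x‖ ^ 2 ≤ ς ^ 2)
    (hσς : 0 < σ ^ 2 + 6 * M * ς ^ 2)
    -- the random choices: workers, averaging matrices, mini-batches
    {Ω : Type*} [MeasurableSpace Ω] (P : Measure Ω) [IsProbabilityMeasure P]
    (i : ℕ → Ω → Fin n) (W : ℕ → Ω → Matrix (Fin n) (Fin n) ℝ) (ξ : ℕ → Ω → Fin M → Z)
    (hi_meas : ∀ k, Measurable (i k)) (hW_meas : ∀ k, Measurable (W k))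
    (hξ_meas : ∀ k, Measurable (ξ k))
    -- the choices made at different iterations are independent
    (h_indep : iIndepFun (fun k ω => (i k ω, W k ω, ξ k ω)) P)
    -- worker `a` is selected with probability `p a`
    (hi_law : ∀ k a, P {ω | i k ω = a} = ENNReal.ofReal (p a))
    -- given the selected worker `a` and the averaging matrix, the mini-batch consists of
    -- `M` independent samples of the local distribution `D a`
    (hξ_law : ∀ k a (A : Set (Matrix (Fin n) (Fin n) ℝ)) (B : Set (Fin M → Z)),
      MeasurableSet A → MeasurableSet B →
      P {ω | i k ω = a ∧ W k ω ∈ A ∧ ξ k ω ∈ B} =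
        P {ω | i k ω = a ∧ W k ω ∈ A} * Measure.pi (fun _ : Fin M => D a) B)
    -- doubly stochastic averaging
    (hW_ds : ∀ k, ∀ᵐ ω ∂P, W k ω ∈ doublyStochastic ℝ (Fin n))
    -- spectral gap: `max (|λ₂|, |λₙ|) ≤ ρ` (no condition if there is only one worker)
    (ρ : ℝ) (hρ_nonneg : 0 ≤ ρ) (hρ_lt : ρ < 1)
    (hρ : ∀ k, ∀ hn : 2 ≤ n,
      max |ADPSGD.eig (ADPSGD.secondMoment_isHermitian P (W k)) ⟨1, by omega⟩|
        |ADPSGD.eig (ADPSGD.secondMoment_isHermitian P (W k)) ⟨n - 1, by omega⟩| ≤ ρ)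
    -- bounded staleness
    (τ : ℕ → ℕ) (hτ_le : ∀ k, τ k ≤ k) (hτ : ∀ k, τ k ≤ T)
    (x₀ : EuclideanSpace ℝ (Fin N))
    -- step size and number of iterations
    (γ : ℝ) (hγ : γ = n / (10 * M * L + √(σ ^ 2 + 6 * M * ς ^ 2) * √(K * M)))
    (hK_large : ADPSGD.iterationThreshold n M T L σ ς ρ ≤ K) :
    (∀ k < K, Integrable (fun ω => ‖gradient (ADPSGD.objective F D p) (ADPSGD.average
      (ADPSGD.iterate F x₀ γ τ (i · ω) (W · ω) (ξ · ω) k))‖ ^ 2) P) ∧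
    (∑ k ∈ Finset.range K, ∫ ω, ‖gradient (ADPSGD.objective F D p) (ADPSGD.average
      (ADPSGD.iterate F x₀ γ τ (i · ω) (W · ω) (ξ · ω) k))‖ ^ 2 ∂P) / K ≤
      20 * (ADPSGD.objective F D p x₀ - ⨅ x, ADPSGD.objective F D p x) * L / K +
      2 * (ADPSGD.objective F D p x₀ - (⨅ x, ADPSGD.objective F D p x) + L) *
        √(σ ^ 2 / M + 6 * ς ^ 2) / √K := by
  have hn : 0 < n := by
    rcases Nat.eq_zero_or_pos n with rfl | hn
    · simp at hp_sum
    · exact hn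
  have hn' : (1 : ℝ) ≤ n := by exact_mod_cast hn
  have hM' : (0 : ℝ) < M := by exact_mod_cast hM
  have hrun := ADPSGD.isRun_iterate hp_nonneg hp_sum hF_meas hf_lip hg_int hg_mean hσ_int hσ
    hi_meas hW_meas hξ_meas h_indep hi_law hξ_law hW_ds τ x₀ γ
  obtain ⟨hγ0, hδ1, hγn, hδ2, hδ3⟩ :=
    ADPSGD.stepSize_mul_le hn hM hK L.coe_nonneg hσς hγ hK_large
  have hφ := ADPSGD.lipschitzWith_gradient_weightedSum hp_nonneg hp_sum hf_diff hf_lip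
  have hmem : ∀ k, MemLp (fun ω => gradient (ADPSGD.objective F D p) (ADPSGD.average
      (ADPSGD.iterate F x₀ γ τ (i · ω) (W · ω) (ξ · ω) k))) 2 P := fun k =>
    ADPSGD.memLp_comp_of_lipschitz hφ (hrun.memLp_average k)
  refine ⟨fun k _ => (hmem k).integrable_norm_pow two_ne_zero, ?_⟩
  refine ADPSGD.rate_of_stepSize hn hM hK L.coe_nonneg hσς hγ hγn ?_
  have hs1 : √ρ < 1 := by
    rw [Real.sqrt_lt' one_pos]
    linarith
  have hs0 := Real.sqrt_nonneg ρ
  -- The midpoint of `√ρ` and `1` is positive even for `ρ = 0`, satisfies `ρ ≤ r²`, and gives `1 - r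
  -- = (1 - √ρ)/2`. The loss of a factor two turns `8` into `32 = √1024` in the condition on `ρ̄`.
  set r := (1 + √ρ) / 2 with hr
  have hr0 : 0 < r := by linarith
  have hr1 : r < 1 := by linarith
  have hρr : ρ ≤ r ^ 2 := by
    rw [← Real.sq_sqrt hρ_nonneg]
    exact pow_le_pow_left₀ hs0 (by linarith) 2
  have hκ : 0 ≤ ((n : ℝ) - 1) / n := div_nonneg (by linarith) (by linarith)
  have hδ0 : 0 ≤ γ * L * M := by positivity
  have hδ3' : 8 * n * (((n : ℝ) - 1) / n * (1 - r)⁻¹ ^ 2) * (γ * L * M) ≤ 1 := by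
    refine le_trans ?_ hδ3
    rw [show 32 * n * ADPSGD.rhoBar n ρ * (γ * L * M) =
      8 * n * (4 * ADPSGD.rhoBar n ρ) * (γ * L * M) by ring]
    exact mul_le_mul_of_nonneg_right (mul_le_mul_of_nonneg_left
      (ADPSGD.inv_one_sub_sq_le_rhoBar hn hρ_nonneg hρ_lt) (by positivity)) hδ0
  have hw1 : 1 ≤ (1 - r)⁻¹ := (one_le_inv₀ (by linarith)).2 (by linarith)
  have hquad : ∀ k (v : Fin n → ℝ), ∑ j, v j = 0 →
      v ⬝ᵥ ADPSGD.secondMoment P (W k) *ᵥ v ≤ ρ * (v ⬝ᵥ v) := fun k v hv =>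
    ADPSGD.secondMoment_quadratic_le (hW_meas k) (hW_ds k) hρ_lt
      (fun hn2 => (le_abs_self _).trans ((le_max_left _ _).trans (hρ k hn2))) hv
  have hbdd : ∀ y, ⨅ x, ADPSGD.objective F D p x ≤
      ∑ a, p a * ADPSGD.localLoss (F a) (D a) y := fun y => ciInf_le hf_bdd y
  -- The noise level is `v = Mσ² + 2M²ς²`, dominated by `M * s` with `s = σ² + 6Mς²`. The sequences
  -- `H` and `Q` are taken at the delayed step `k - τ k`.
  refine ADPSGD.sum_grad_le (e := fun k => ∫ ω, (∑ a, p a * ADPSGD.localLoss (F a) (D a)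
      (ADPSGD.average fun j => ADPSGD.iterate F x₀ γ τ (i · ω) (W · ω) (ξ · ω) k j)) ∂P)
    hτ (by positivity) hM' L.coe_nonneg hγ0 hr0 hr1
    (fun k => integral_nonneg fun _ => sq_nonneg _) (fun k => integral_nonneg fun _ => sq_nonneg _)
    (fun k => Finset.sum_nonneg fun a _ =>
      mul_nonneg (hp_nonneg a) (integral_nonneg fun _ => sq_nonneg _))
    hκ (by positivity : 0 ≤ M * σ ^ 2 + 2 * M ^ 2 * ς ^ 2) ?_ ?_ ?_
    (hrun.integral_objective_succ_le hf_diff hbdd)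
    (hrun.integral_norm_gradient_sub_sq_le hf_diff hτ) (hrun.integral_norm_g_sq_le hς) ?_
    hδ1 hδ2 hδ3' (ADPSGD.stepSize_sq_mul_le hn hδ0 hw1 hδ2 hδ3')
  · have : 0 ≤ (M : ℝ) ^ 2 * ς ^ 2 := by positivity
    linarith
  · have h0 : ∀ ω, (ADPSGD.average fun j =>
        ADPSGD.iterate F x₀ γ τ (i · ω) (W · ω) (ξ · ω) 0 j) = x₀ := fun ω => by
      simp only [ADPSGD.iterate_zero, ADPSGD.average, Finset.sum_const, Finset.card_univ,
        Fintype.card_fin, ← Nat.cast_smul_eq_nsmul ℝ, smul_smul]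
      rw [inv_mul_cancel₀ (by positivity), one_smul]
    simp only [h0, integral_const, probReal_univ, one_smul]
    rfl
  · have h1 := integral_mono (integrable_const (⨅ x, ADPSGD.objective F D p x))
      (hrun.integrable_objective hf_diff hbdd K) fun ω => hbdd _
    simpa using h1
  · intro k
    have h1 := fun a => hrun.integral_norm_sub_average_sq_le hρ_nonneg hquad hr0 hr1 hρr (k - τ k) a
    refine (Finset.sum_le_sum fun a _ =>
      mul_le_mul_of_nonneg_left (h1 a) (hp_nonneg a)).trans_eq ?_
    -- The consensus bound is the same for every worker, so the `p`-weighted mean inherits it.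
    rw [← Finset.sum_mul, hp_sum, one_mul]
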